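/- Let $\Omega_n=\{0,1\}^n$ with the coordinatewise order and the uniform probability measure $\mu$. For $x\in\Omega_n$ let $x\oplus e_k$ be $x$ with its $k$-th coordinate $x_k$ replaced by $1-x_k$. A family $\mathcal A\subset\Omega_n$ is increasing if $x\in\mathcal A$, $x\le y$ imply $y\in\mathcal A$, and fully symmetric if it is invariant under all permutations of the $n$ coordinates. Write $\mathrm{Cov}(\mathcal A,\mathcal B)=\mu(\mathcal A\cap\mathcal B)-\mu(\mathcal A)\mu(\mathcal B)$, $I_k(\mathcal A)=2\mu(\{x\in\mathcal A: x\oplus e_k\notin\mathcal A\})$ and $\mathcal W_1(\mathcal B,\mathcal B)=\sum_{i=1}^n I_i(\mathcal B)^2$. For functions $f,g:\Omega_n\to\mathbb R$ write $\mathrm{Cov}(f,g)=\mathbb E[fg]-\mathbb E[f]\mathbb E[g]$ and $I_k(f)=\mathbb E[|f(x)-f(x\oplus e_k)|]$, with expectations under $\mu$; $f$ is increasing if $x\le y$ implies $f(x)\le f(y)$, and fully symmetric if it is invariant under all permutations of the coordinates. All quotients below whose numerator is an influence equal to $0$ are read as $0$. **Theorem.** (1) There are universal constants $c_1,c_2>0$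 such that for every $n$ and all increasing $\mathcal A,\mathcal B\subset\Omega_n$ with $\mathcal B$ fully symmetric, $$\mathrm{Cov}(\mathcal A,\mathcal B)\ \ge\ c_1\sum_{i=1}^n\frac{I_i(\mathcal A)}{\sqrt{\log\frac{e}{I_i(\mathcal A)}}}\cdot\frac{I_i(\mathcal B)}{\sqrt{\log\frac{e^2}{\mathcal W_1(\mathcal B,\mathcal B)}}}\ \ge\ c_2\,\frac{\mu(\mathcal B)(1-\mu(\mathcal B))}{\sqrt n}\sum_{i=1}^n\frac{I_i(\mathcal A)}{\sqrt{\log\frac{e}{I_i(\mathcal A)}}}.$$ (2) (General form for bounded functions.) There is a universal constant $c>0$ such that for every $n$ and all increasing $f,g:\Omega_n\to[-1,1]$ with $f$ fully symmetric, $$\mathrm{Cov}(f,g)\ \ge\ c\sum_{i=1}^n\frac{I_i(f)}{\sqrt{\log\frac{e^3}{n I_i(f)^2}}}\cdot\frac{I_i(g)}{\sqrt{\log\frac{e^2}{I_i(g)}}}.$$ -/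

import Mathlib

namespace DiscreteCube

/-- The discrete cube `{0,1}^n`, with its coordinatewise partial order (`false < true`). -/
abbrev Cube (n : ℕ) : Type := Fin n → Bool

/-- The point `x ⊕ e_k`, obtained from `x` by replacing `x_k` by `1 - x_k`. -/
def flip {n : ℕ} (k : Fin n) (x : Cube n) : Cube n := Function.update x k (!(x k))

/-! ### Families of points of the cube -/

/-- The uniform probability measure of a family. -/
noncomputable def mu {n : ℕ} (A : Finset (Cube n)) : ℝ := (A.card : ℝ) / 2 ^ n

/-- The covariance of two families, `μ(A ∩ B) - μ(A) μ(B)`. -/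
noncomputable def cov {n : ℕ} (A B : Finset (Cube n)) : ℝ := mu (A ∩ B) - mu A * mu B

/-- A family is increasing if it contains every point above one of its points. -/
def Increasing {n : ℕ} (A : Finset (Cube n)) : Prop :=
  ∀ x y : Cube n, x ∈ A → x ≤ y → y ∈ A

/-- A family is fully symmetric if it is invariant under all permutations of the coordinates. -/
def FullySymmetric {n : ℕ} (A : Finset (Cube n)) : Prop :=
  ∀ (σ : Equiv.Perm (Fin n)) (x : Cube n), x ∘ σ ∈ A ↔ x ∈ A

/-- The influence of the `k`-th variable on a family, `2 μ({x ∈ A | x ⊕ e_k ∉ A})`. -/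
noncomputable def influence {n : ℕ} (A : Finset (Cube n)) (k : Fin n) : ℝ :=
  2 * mu (A.filter fun x => flip k x ∉ A)

/-- `W₁(A, B) = ∑ i, I_i(A) I_i(B)`. -/
noncomputable def W1 {n : ℕ} (A B : Finset (Cube n)) : ℝ :=
  ∑ i, influence A i * influence B i

/-- `ψ(x) = x / √(log (e / x))`; in particular `ψ(0) = 0`. -/
noncomputable def psi (x : ℝ) : ℝ := x / √(Real.log (Real.exp 1 / x))

/-! ### Real functions on the cube -/

/-- The expectation of a function with respect to the uniform measure. -/
noncomputable def expect {n : ℕ} (f : Cube n → ℝ) : ℝ := (∑ x, f x) / 2 ^ n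

/-- The covariance of two functions, `E[fg] - E[f] E[g]`. -/
noncomputable def covFun {n : ℕ} (f g : Cube n → ℝ) : ℝ :=
  expect (fun x => f x * g x) - expect f * expect g

/-- The influence of the `k`-th variable on a function, `E[|f(x) - f(x ⊕ e_k)|]`. -/
noncomputable def influenceFun {n : ℕ} (f : Cube n → ℝ) (k : Fin n) : ℝ :=
  expect fun x => |f x - f (flip k x)|

/-- A function is fully symmetric if it is invariant under all permutations of the coordinates. -/
def FullySymmetricFun {n : ℕ} (f : Cube n → ℝ) : Prop :=
  ∀ (σ : Equiv.Perm (Fin n)) (x : Cube n), f (x ∘ σ) = f x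

end DiscreteCube

/-!
Let `x` and `y` be uniform points of the cube whose `k`-th coordinates have correlation `ρ k`. For
increasing `f` and `g`, raising all correlations from `0` (independent points) to `1` (equal
points) raises `E[f(x) g(y)]` by `Cov(f, g)`, and its derivative in `ρ k` is
`E[D_k f(x) D_k g(y)] ≥ 0`. Stop at `ρ k = r k`, where `r k = 1 / (2 √log(e² / I_k(g)))`, and raise
the correlations in increasing order of `r`. If `f` is the truncated normalized sum of the
coordinates, then given `y` its derivative is about `1 / √n` unless `∑ j, ρ j y_j` is of order
`√n`. While all correlations are at most `r k`, this event has probability well below `I_k(g)`, so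
that `Cov(f, g) ≥ c / √n * ∑ k, I_k(g) / √log(e² / I_k(g))`.

Only the symmetrization of `g` matters for its covariance with a symmetric function, and all
symmetric increasing functions are comonotone. Chebyshev's inequality for comonotone functions `f`
and `g`, improved to `Cov(f, g) ≥ E|f - f(w)| * E|g - g(w)|` for a common median point `w`,
therefore replaces the truncated sum by any symmetric increasing `f : Ω_n → [-1, 1]`, at the cost
of a factor `E|f - f(w)|`. By the level-one inequality, `√n * I_k(f)` is at most of order
`E|f - f(w)| * √log(e³ / (n * I_k(f)²))`.

For the second inequality, a symmetric increasing family is a superlevel set of the normalized sum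
`L`. If it has the form `L ≥ β` with `β ≥ 0`, then `√n` times its influence is `2 E[1_B L]`, which
is at least of order `μ(B) * max(1, β)`, while `μ(B) ≥ exp(-C max(1, β)²)`. Otherwise pass to the
complement.
-/

namespace DiscreteCube

open Finset

variable {n : ℕ}

/-! ### Expectations -/

theorem expect_add (f g : Cube n → ℝ) :
    expect (fun x => f x + g x) = expect f + expect g := by
  simp only [expect, sum_add_distrib, add_div]

theorem expect_sub (f g : Cube n → ℝ) :
    expect (fun x => f x - g x) = expect f - expect g := by
  simp only [expect, sum_sub_distrib, sub_div]

theorem expect_const_mul (c : ℝ) (f : Cube n → ℝ) :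
    expect (fun x => c * f x) = c * expect f := by
  simp only [expect, ← mul_sum, mul_div_assoc]

theorem expect_mul_const (f : Cube n → ℝ) (c : ℝ) :
    expect (fun x => f x * c) = expect f * c := by
  simp only [mul_comm _ c, expect_const_mul]

theorem expect_const (c : ℝ) : expect (fun _ : Cube n => c) = c := by
  simp [expect]

theorem expect_sum {ι : Type*} (s : Finset ι) (f : ι → Cube n → ℝ) :
    expect (fun x => ∑ i ∈ s, f i x) = ∑ i ∈ s, expect (f i) := by
  simp only [expect]
  rw [sum_comm, sum_div]

theorem expect_mono {f g : Cube n → ℝ} (h : ∀ x, f x ≤ g x) : expect f ≤ expect g := by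
  unfold expect
  gcongr
  exact h _

theorem expect_nonneg {f : Cube n → ℝ} (h : ∀ x, 0 ≤ f x) : 0 ≤ expect f := by
  rw [← expect_const (n := n) 0]
  exact expect_mono h

theorem expect_mem_Icc {f : Cube n → ℝ} {a b : ℝ} (h : ∀ x, f x ∈ Set.Icc a b) :
    expect f ∈ Set.Icc a b := by
  constructor
  · rw [← expect_const (n := n) a]
    exact expect_mono fun x => (h x).1
  · rw [← expect_const (n := n) b]
    exact expect_mono fun x => (h x).2

theorem expect_comp_equiv (e : Cube n ≃ Cube n) (f : Cube n → ℝ) :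
    expect (fun x => f (e x)) = expect f := by
  unfold expect
  rw [e.sum_comp]

theorem expect_comp_perm (σ : Equiv.Perm (Fin n)) (f : Cube n → ℝ) :
    expect (fun x => f (x ∘ σ)) = expect f :=
  expect_comp_equiv (Equiv.arrowCongr σ.symm (Equiv.refl Bool)) f

theorem expect_prod (φ : Fin n → Bool → ℝ) :
    expect (fun x => ∏ j, φ j (x j)) = ∏ j, (φ j true + φ j false) / 2 := by
  have h := Finset.prod_univ_sum (fun _ : Fin n => (univ : Finset Bool)) φ
  rw [Fintype.piFinset_univ] at h
  unfold expect
  rw [← h, prod_div_distrib]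
  simp

theorem sq_expect_mul_le (f g : Cube n → ℝ) :
    expect (fun x => f x * g x) ^ 2 ≤
      expect (fun x => f x ^ 2) * expect (fun x => g x ^ 2) := by
  have h := sum_mul_sq_le_sq_mul_sq univ f g
  rw [expect, expect, expect, div_pow, div_mul_div_comm, ← sq]
  gcongr

theorem covFun_eq_expect (f g : Cube n → ℝ) (α : ℝ) :
    covFun f g = expect fun x => (f x - expect f) * (g x - α) := by
  have expand : (fun x => (f x - expect f) * (g x - α)) = fun x =>
      (f x * g x - expect f * g x) - (α * f x - α * expect f) := by
    funext x
    ring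
  rw [expand, expect_sub, expect_sub, expect_sub, expect_const_mul, expect_const_mul,
    expect_const, covFun]
  ring

theorem covFun_comm (f g : Cube n → ℝ) : covFun f g = covFun g f := by
  simp only [covFun, mul_comm]

/-! ### Chebyshev's inequality with a remainder -/

theorem exists_median {ι α : Type*} [Fintype ι] [Nonempty ι] [LinearOrder α] (h : ι → α) :
    ∃ w, 2 * #{x | h w < h x} ≤ Fintype.card ι ∧ 2 * #{x | h x < h w} ≤ Fintype.card ι := by
  obtain ⟨top, htop⟩ := Finite.exists_max h
  obtain ⟨w, hw, hmin⟩ :=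
    exists_min_image {w | 2 * #{x | h w < h x} ≤ Fintype.card ι} h
      ⟨top, by simp [filter_false_of_mem fun x _ => (htop x).not_gt]⟩
  rw [mem_filter_univ] at hw
  refine ⟨w, hw, ?_⟩
  by_contra! hlow
  obtain ⟨v, hv, hmax⟩ := exists_max_image {x | h x < h w} h
    (card_pos.1 (by omega))
  rw [mem_filter_univ] at hv
  have hvhigh : ¬ 2 * #{x | h v < h x} ≤ Fintype.card ι := fun hv' =>
    (hmin v (by simpa only [mem_filter_univ] using hv')).not_gt hv
  have hdisj : Disjoint ({x | h v < h x} : Finset ι) ({x | h x < h w} : Finset ι) := by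
    refine disjoint_filter.2 fun x _ hvx hxw => ?_
    exact (hmax x (by simpa only [mem_filter_univ] using hxw)).not_gt hvx
  have := card_le_univ (disjUnion _ _ hdisj)
  rw [card_disjUnion] at this
  omega

theorem nonpos_of_add_nonpos_of_mul_nonneg {a b : ℝ} (hab : 0 ≤ a * b) (h : a + b ≤ 0) :
    a ≤ 0 ∧ b ≤ 0 := by
  constructor <;> nlinarith

theorem mul_eq_posPart_mul_posPart_add_negPart_mul_negPart {a b : ℝ} (h : 0 ≤ a * b) :
    a * b = a⁺ * b⁺ + a⁻ * b⁻ := by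
  rcases mul_nonneg_iff.1 h with ⟨ha, hb⟩ | ⟨ha, hb⟩
  · simp [ha, hb]
  · simp [posPart_of_nonpos, negPart_of_nonpos, ha, hb]

section Chebyshev

variable {ι : Type*} [Fintype ι] {f g : ι → ℝ}

theorem two_mul_sum_posPart_mul_sum_posPart_le (hfg : Monovary f g)
    (hsign : ∀ x, 0 ≤ f x * g x) (hcard : 2 * #{x | 0 < f x + g x} ≤ Fintype.card ι) :
    2 * ((∑ x, (f x)⁺) * ∑ x, (g x)⁺) ≤ Fintype.card ι * ∑ x, (f x)⁺ * (g x)⁺ := by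
  set s : Finset ι := {x | 0 < f x + g x}
  have nonpos : ∀ x ∉ s, f x ≤ 0 ∧ g x ≤ 0 := fun x hx =>
    nonpos_of_add_nonpos_of_mul_nonneg (hsign x)
      (not_lt.1 (by simpa only [s, mem_filter_univ] using hx))
  have restrict : ∀ φ : ι → ℝ, (∀ x ∉ s, φ x = 0) → ∑ x, φ x = ∑ x ∈ s, φ x :=
    fun φ hφ => (sum_subset (subset_univ s) fun x _ hx => hφ x hx).symm
  have hmono : MonovaryOn (fun x => (f x)⁺) (fun x => (g x)⁺) s := fun x _ y _ hxy =>
    posPart_mono (hfg (not_le.1 fun h => hxy.not_ge (posPart_mono h)))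
  have chebyshev := hmono.sum_mul_sum_le_card_mul_sum
  rw [restrict _ fun x hx => posPart_of_nonpos (nonpos x hx).1,
    restrict _ fun x hx => posPart_of_nonpos (nonpos x hx).2,
    restrict _ fun x hx => by rw [posPart_of_nonpos (nonpos x hx).1, zero_mul]]
  have hcard' : 2 * (#s : ℝ) ≤ Fintype.card ι := by exact_mod_cast hcard
  have hnonneg : 0 ≤ ∑ x ∈ s, (f x)⁺ * (g x)⁺ := sum_nonneg fun x _ => by positivity
  nlinarith [mul_le_mul_of_nonneg_right hcard' hnonneg]

theorem sum_abs_mul_sum_abs_le (hfg : Monovary f g) (hsign : ∀ x, 0 ≤ f x * g x)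
    (hpos : 2 * #{x | 0 < f x + g x} ≤ Fintype.card ι)
    (hneg : 2 * #{x | f x + g x < 0} ≤ Fintype.card ι) :
    (∑ x, |f x|) * ∑ x, |g x| ≤
      Fintype.card ι * (∑ x, f x * g x) - (∑ x, f x) * ∑ x, g x := by
  have high := two_mul_sum_posPart_mul_sum_posPart_le hfg hsign hpos
  have low := two_mul_sum_posPart_mul_sum_posPart_le (f := -f) (g := -g) hfg.neg
    (fun x => by simpa using hsign x)
    (by simpa only [Pi.neg_apply, ← neg_add, neg_pos] using hneg)
  simp only [Pi.neg_apply, posPart_neg] at low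
  have hprod : ∑ x, f x * g x = ∑ x, (f x)⁺ * (g x)⁺ + ∑ x, (f x)⁻ * (g x)⁻ := by
    rw [← sum_add_distrib]
    exact sum_congr rfl fun x _ => mul_eq_posPart_mul_posPart_add_negPart_mul_negPart (hsign x)
  have habs : ∀ φ : ι → ℝ, ∑ x, |φ x| = ∑ x, (φ x)⁺ + ∑ x, (φ x)⁻ := fun φ => by
    simp only [← posPart_add_negPart, sum_add_distrib]
  have hsum : ∀ φ : ι → ℝ, ∑ x, φ x = ∑ x, (φ x)⁺ - ∑ x, (φ x)⁻ := fun φ => by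
    simp only [← sum_sub_distrib, posPart_sub_negPart]
  rw [hprod, habs f, habs g, hsum f, hsum g]
  linarith

/-- Subtracting the values at a point `w` where `f + g` is median improves Chebyshev's inequality:
the positive parts of `f - f w` and `g - g w` live on at most half of the points, and so do the
negative parts. -/
theorem exists_sum_abs_sub_mul_sum_abs_sub_le [Nonempty ι] (hfg : Monovary f g) :
    ∃ w, (∑ x, |f x - f w|) * ∑ x, |g x - g w| ≤
      Fintype.card ι * (∑ x, f x * g x) - (∑ x, f x) * ∑ x, g x := by
  obtain ⟨w, hhigh, hlow⟩ := exists_median (f + g)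
  have sub_add_sub (x : ι) : f x - f w + (g x - g w) = (f + g) x - (f + g) w := by
    simp only [Pi.add_apply]
    ring
  have key := sum_abs_mul_sum_abs_le (f := fun x => f x - f w) (g := fun x => g x - g w)
    (fun x y hxy => by simpa using hfg (by simpa using hxy))
    (fun x => monovary_iff_forall_mul_nonneg.1 hfg w x)
    (by simpa only [sub_add_sub, sub_pos] using hhigh)
    (by simpa only [sub_add_sub, sub_neg] using hlow)
  refine ⟨w, key.trans_eq ?_⟩
  simp only [sub_mul, mul_sub, sum_sub_distrib, ← sum_mul, ← mul_sum, sum_const, card_univ,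
    nsmul_eq_mul]
  ring

end Chebyshev

theorem exists_expect_abs_sub_mul_expect_abs_sub_le {f g : Cube n → ℝ} (hfg : Monovary f g) :
    ∃ w, (expect fun x => |f x - f w|) * (expect fun x => |g x - g w|) ≤ covFun f g := by
  obtain ⟨w, hw⟩ := exists_sum_abs_sub_mul_sum_abs_sub_le hfg
  refine ⟨w, ?_⟩
  rw [Fintype.card_pi_const, Fintype.card_bool] at hw
  push_cast at hw
  have hcov : covFun f g =
      (2 ^ n * (∑ x, f x * g x) - (∑ x, f x) * ∑ x, g x) / (2 ^ n * 2 ^ n) := by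
    simp only [covFun, expect]
    field_simp
  rw [hcov, expect, expect, div_mul_div_comm]
  gcongr

/-! ### Discrete derivatives -/

theorem flip_flip (k : Fin n) (x : Cube n) : flip k (flip k x) = x := by
  simp [flip]

theorem flip_apply_self (k : Fin n) (x : Cube n) : flip k x k = !x k := by
  simp [flip]

theorem flip_apply_of_ne {k j : Fin n} (h : j ≠ k) (x : Cube n) : flip k x j = x j := by
  simp [flip, h]

theorem expect_flip (k : Fin n) (f : Cube n → ℝ) :
    expect (fun x => f (flip k x)) = expect f :=
  expect_comp_equiv (Function.Involutive.toPerm (flip k) (flip_flip k)) f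

theorem flip_le {k : Fin n} {x : Cube n} (h : x k = true) : flip k x ≤ x := by
  intro j
  rcases eq_or_ne j k with rfl | hj
  · exact h ▸ Bool.le_true _
  · exact (flip_apply_of_ne hj x).le

theorem le_flip {k : Fin n} {x : Cube n} (h : x k = false) : x ≤ flip k x := by
  intro j
  rcases eq_or_ne j k with rfl | hj
  · exact h ▸ Bool.false_le _
  · exact (flip_apply_of_ne hj x).ge

/-- The coordinate `b` of a point of the cube in the `±1` convention. -/
noncomputable def sgn (b : Bool) : ℝ := if b then 1 else -1

@[simp] theorem sgn_true : sgn true = 1 := rfl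

@[simp] theorem sgn_false : sgn false = -1 := by simp [sgn]

theorem sgn_not (b : Bool) : sgn (!b) = -sgn b := by cases b <;> simp

theorem sgn_mono : Monotone sgn := by
  rintro (_ | _) (_ | _) h <;> first | exact absurd h (by decide) | norm_num

theorem sgn_mul_self (b : Bool) : sgn b * sgn b = 1 := by cases b <;> simp

/-- The discrete derivative `(f(x^{k→1}) - f(x^{k→0})) / 2` of `f` in the direction `k`. The factor
`1/2` makes it the derivative of the multilinear extension of `f` in the `±1` convention. -/
noncomputable def discDeriv (k : Fin n) (f : Cube n → ℝ) (x : Cube n) : ℝ :=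
  sgn (x k) * (f x - f (flip k x)) / 2

theorem discDeriv_flip (k : Fin n) (f : Cube n → ℝ) (x : Cube n) :
    discDeriv k f (flip k x) = discDeriv k f x := by
  rw [discDeriv, discDeriv, flip_flip, flip_apply_self, sgn_not]
  ring

theorem discDeriv_const (k : Fin n) (c : ℝ) (x : Cube n) : discDeriv k (fun _ => c) x = 0 := by
  rw [discDeriv, sub_self, mul_zero, zero_div]

theorem discDeriv_discDeriv (k : Fin n) (f : Cube n → ℝ) (x : Cube n) :
    discDeriv k (discDeriv k f) x = 0 := by
  rw [discDeriv, discDeriv_flip, sub_self, mul_zero, zero_div]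

theorem discDeriv_eq_abs {f : Cube n → ℝ} (hf : Monotone f) (k : Fin n) (x : Cube n) :
    discDeriv k f x = |f x - f (flip k x)| / 2 := by
  unfold discDeriv
  cases h : x k
  · rw [abs_of_nonpos (sub_nonpos.2 (hf (le_flip h)))]
    simp
  · rw [abs_of_nonneg (sub_nonneg.2 (hf (flip_le h)))]
    simp

theorem discDeriv_nonneg {f : Cube n → ℝ} (hf : Monotone f) (k : Fin n) (x : Cube n) :
    0 ≤ discDeriv k f x := by
  rw [discDeriv_eq_abs hf]
  positivity

theorem discDeriv_le_one {f : Cube n → ℝ} (h : ∀ x, f x ∈ Set.Icc (-1 : ℝ) 1) (k : Fin n)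
    (x : Cube n) : discDeriv k f x ≤ 1 := by
  obtain ⟨lower, upper⟩ := h x
  obtain ⟨lower', upper'⟩ := h (flip k x)
  unfold discDeriv
  cases x k <;> simp <;> linarith

theorem expect_mul_sgn_mul (k : Fin n) (f : Cube n → ℝ) {w : Cube n → ℝ}
    (hw : ∀ x, w (flip k x) = w x) :
    expect (fun x => f x * sgn (x k) * w x) = expect fun x => discDeriv k f x * w x := by
  have hflip := expect_flip k fun x => f x * sgn (x k) * w x
  simp only [hw, flip_apply_self, sgn_not] at hflip
  have average : (fun x => discDeriv k f x * w x) = fun x =>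
      (1 / 2) * (f x * sgn (x k) * w x + f (flip k x) * -sgn (x k) * w x) := by
    funext x
    unfold discDeriv
    ring
  rw [average, expect_const_mul, expect_add, hflip]
  ring

theorem expect_mul_sgn (k : Fin n) (f : Cube n → ℝ) :
    expect (fun x => f x * sgn (x k)) = expect (discDeriv k f) := by
  simpa only [mul_one] using expect_mul_sgn_mul k f (w := fun _ => 1) fun _ => rfl

theorem influenceFun_nonneg (f : Cube n → ℝ) (k : Fin n) : 0 ≤ influenceFun f k :=
  expect_nonneg fun _ => abs_nonneg _

theorem influenceFun_eq_two_mul {f : Cube n → ℝ} (hf : Monotone f) (k : Fin n) :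
    influenceFun f k = 2 * expect (discDeriv k f) := by
  rw [← expect_const_mul]
  unfold influenceFun
  congr 1
  funext x
  rw [discDeriv_eq_abs hf, mul_div_cancel₀ _ two_ne_zero]

theorem influenceFun_le_two {f : Cube n → ℝ} (hf : Monotone f)
    (h : ∀ x, f x ∈ Set.Icc (-1 : ℝ) 1) (k : Fin n) : influenceFun f k ≤ 2 := by
  have := expect_mono (discDeriv_le_one h k)
  rw [expect_const] at this
  linarith [influenceFun_eq_two_mul hf k]

/-! ### Correlated pairs of points -/

/-- The density, with respect to the uniform measure on pairs, of a pair of uniform points whose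
`j`-th coordinates have correlation `ρ j`, independently over `j`. -/
noncomputable def kernel (ρ : Fin n → ℝ) (x y : Cube n) : ℝ :=
  ∏ j, (1 + ρ j * (sgn (x j) * sgn (y j)))

/-- The noise operator: `noise ρ f y` is the conditional expectation of `f x` given `y`, for a pair
`(x, y)` with correlations `ρ`. -/
noncomputable def noise (ρ : Fin n → ℝ) (f : Cube n → ℝ) (y : Cube n) : ℝ :=
  expect fun x => f x * kernel ρ x y

/-- The expectation of `f x * g y` for a pair `(x, y)` with correlations `ρ`. -/
noncomputable def corr (ρ : Fin n → ℝ) (f g : Cube n → ℝ) : ℝ :=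
  expect fun y => noise ρ f y * g y

theorem kernel_nonneg {ρ : Fin n → ℝ} (h : ∀ j, ρ j ∈ Set.Icc (0 : ℝ) 1) (x y : Cube n) :
    0 ≤ kernel ρ x y := by
  refine prod_nonneg fun j _ => ?_
  obtain ⟨_, _⟩ := h j
  cases x j <;> cases y j <;> simp <;> linarith

theorem noise_nonneg {ρ : Fin n → ℝ} (h : ∀ j, ρ j ∈ Set.Icc (0 : ℝ) 1) {f : Cube n → ℝ}
    (hf : ∀ x, 0 ≤ f x) (y : Cube n) : 0 ≤ noise ρ f y :=
  expect_nonneg fun x => mul_nonneg (hf x) (kernel_nonneg h x y)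

theorem corr_nonneg {ρ : Fin n → ℝ} (h : ∀ j, ρ j ∈ Set.Icc (0 : ℝ) 1) {f g : Cube n → ℝ}
    (hf : ∀ x, 0 ≤ f x) (hg : ∀ x, 0 ≤ g x) : 0 ≤ corr ρ f g :=
  expect_nonneg fun y => mul_nonneg (noise_nonneg h hf y) (hg y)

theorem corr_zero (f g : Cube n → ℝ) : corr 0 f g = expect f * expect g := by
  simp only [corr, noise, kernel, Pi.zero_apply, zero_mul, add_zero, prod_const_one, mul_one,
    expect_const_mul]

theorem kernel_one (x y : Cube n) : kernel 1 x y = if x = y then 2 ^ n else 0 := by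
  unfold kernel
  split_ifs with h
  · subst h
    simp only [sgn_mul_self, Pi.one_apply]
    norm_num
  · obtain ⟨j, hj⟩ := Function.ne_iff.1 h
    refine prod_eq_zero (mem_univ j) ?_
    revert hj
    cases x j <;> cases y j <;> simp

theorem corr_one (f g : Cube n → ℝ) : corr 1 f g = expect fun x => f x * g x := by
  have noise_one : noise 1 f = f := by
    funext y
    simp [noise, expect, kernel_one]
  rw [corr, noise_one]

theorem covFun_eq_corr_sub (f g : Cube n → ℝ) : covFun f g = corr 1 f g - corr 0 f g := by
  rw [corr_one, corr_zero, covFun]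

theorem kernel_update (ρ : Fin n → ℝ) (k : Fin n) (b : ℝ) (x y : Cube n) :
    kernel (Function.update ρ k b) x y =
      (1 + b * (sgn (x k) * sgn (y k))) * kernel (Function.update ρ k 0) x y := by
  unfold kernel
  rw [← mul_prod_erase univ _ (mem_univ k), ← mul_prod_erase univ _ (mem_univ k)]
  simp only [Function.update_self, zero_mul, add_zero, one_mul]
  congr 1
  refine prod_congr rfl fun j hj => ?_
  rw [Function.update_of_ne (ne_of_mem_erase hj), Function.update_of_ne (ne_of_mem_erase hj)]

theorem kernel_flip_left {ρ : Fin n → ℝ} {k : Fin n} (h : ρ k = 0) (x y : Cube n) :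
    kernel ρ (flip k x) y = kernel ρ x y := by
  refine prod_congr rfl fun j _ => ?_
  rcases eq_or_ne j k with rfl | hj
  · rw [h, zero_mul, zero_mul]
  · rw [flip_apply_of_ne hj]

theorem kernel_comm (ρ : Fin n → ℝ) (x y : Cube n) : kernel ρ x y = kernel ρ y x :=
  prod_congr rfl fun j _ => by rw [mul_comm (sgn (x j))]

theorem noise_flip {ρ : Fin n → ℝ} {k : Fin n} (h : ρ k = 0) (f : Cube n → ℝ) (y : Cube n) :
    noise ρ f (flip k y) = noise ρ f y := by
  simp only [noise, kernel_comm ρ _ (flip k y), kernel_comm ρ _ y, kernel_flip_left h]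

theorem noise_update (ρ : Fin n → ℝ) (k : Fin n) (b : ℝ) (f : Cube n → ℝ) (y : Cube n) :
    noise (Function.update ρ k b) f y = noise (Function.update ρ k 0) f y +
      b * sgn (y k) * noise (Function.update ρ k 0) (discDeriv k f) y := by
  have hk : Function.update ρ k 0 k = 0 := Function.update_self ..
  rw [noise, noise, noise, ← expect_mul_sgn_mul k f fun x => kernel_flip_left hk x y,
    ← expect_const_mul, ← expect_add]
  congr 1
  funext x
  rw [kernel_update ρ k b]
  ring

theorem corr_update_eq_corr_update_zero_add (ρ : Fin n → ℝ) (k : Fin n) (b : ℝ)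
    (f g : Cube n → ℝ) :
    corr (Function.update ρ k b) f g = corr (Function.update ρ k 0) f g +
      b * corr (Function.update ρ k 0) (discDeriv k f) (discDeriv k g) := by
  have hk : Function.update ρ k 0 k = 0 := Function.update_self ..
  have slope := expect_mul_sgn_mul k g fun y => noise_flip hk (discDeriv k f) y
  simp only [corr, mul_comm (noise _ (discDeriv k f) _)]
  rw [← slope, ← expect_const_mul, ← expect_add]
  congr 1
  funext y
  rw [noise_update]
  ring

theorem corr_update (ρ : Fin n → ℝ) (k : Fin n) (b : ℝ) (f g : Cube n → ℝ) :
    corr (Function.update ρ k b) f g =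
      corr ρ f g + (b - ρ k) * corr ρ (discDeriv k f) (discDeriv k g) := by
  have at_self := corr_update_eq_corr_update_zero_add ρ k (ρ k) f g
  have slope := corr_update_eq_corr_update_zero_add ρ k (ρ k) (discDeriv k f) (discDeriv k g)
  have slope_slope : corr (Function.update ρ k 0) (discDeriv k (discDeriv k f))
      (discDeriv k (discDeriv k g)) = 0 := by
    rw [funext (discDeriv_discDeriv k g)]
    simp only [corr, mul_zero, expect_const]
  rw [Function.update_eq_self] at at_self slope
  rw [corr_update_eq_corr_update_zero_add, at_self, slope, slope_slope]
  ring

theorem corr_mono {f g : Cube n → ℝ} (hf : Monotone f) (hg : Monotone g) {ρ τ : Fin n → ℝ}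
    (hρ : ∀ j, 0 ≤ ρ j) (hρτ : ρ ≤ τ) (hτ : ∀ j, τ j ≤ 1) : corr ρ f g ≤ corr τ f g := by
  suffices ∀ s : Finset (Fin n), corr ρ f g ≤ corr (s.piecewise τ ρ) f g by
    simpa only [piecewise_univ] using this univ
  intro s
  induction s using Finset.induction_on with
  | empty => rw [piecewise_empty]
  | insert k s hk ih =>
    rw [piecewise_insert, corr_update, piecewise_eq_of_notMem s τ ρ hk]
    refine ih.trans (le_add_of_nonneg_right (mul_nonneg (sub_nonneg.2 (hρτ k)) ?_))
    refine corr_nonneg (fun j => ?_) (discDeriv_nonneg hf k) (discDeriv_nonneg hg k)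
    exact ⟨(hρ j).trans (le_piecewise_of_le_of_le s hρτ le_rfl j),
      (piecewise_le_of_le_of_le s le_rfl hρτ j).trans (hτ j)⟩

/-- The correlations are raised from `0` to `R k` one at a time, in increasing order of `R`, so that
the step at `k` only sees correlations which are at most `R k`. -/
theorem corr_zero_add_sum_le {f g : Cube n → ℝ} {R w : Fin n → ℝ} (hR : ∀ k, 0 ≤ R k)
    (hw : ∀ k (ρ : Fin n → ℝ), (∀ j, ρ j ∈ Set.Icc 0 (R k)) →
      w k ≤ R k * corr ρ (discDeriv k f) (discDeriv k g)) :
    corr 0 f g + ∑ k, w k ≤ corr R f g := by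
  suffices ∀ s : Finset (Fin n), corr 0 f g + ∑ k ∈ s, w k ≤ corr (s.piecewise R 0) f g by
    simpa only [piecewise_univ] using this univ
  intro s
  induction s using Finset.induction_on_max_value R with
  | empty => simp
  | insert k s hk hmax ih =>
    rw [piecewise_insert, corr_update, piecewise_eq_of_notMem s R 0 hk, sum_insert hk,
      Pi.zero_apply, sub_zero]
    have := hw k (s.piecewise R 0) fun j => by
      by_cases hj : j ∈ s
      · simpa only [piecewise_eq_of_mem s R 0 hj] using ⟨hR j, hmax j hj⟩
      · simpa only [piecewise_eq_of_notMem s R 0 hj] using ⟨le_rfl, hR k⟩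
    linarith

/-! ### Linear forms -/

/-- The linear form with coefficients `a`, in the `±1` convention: a weighted sum of independent
uniform signs. -/
noncomputable def linForm (a : Fin n → ℝ) (x : Cube n) : ℝ := ∑ j, a j * sgn (x j)

theorem linForm_neg (a : Fin n → ℝ) (x : Cube n) : linForm (-a) x = -linForm a x := by
  simp only [linForm, Pi.neg_apply, neg_mul, sum_neg_distrib]

theorem linForm_smul (c : ℝ) (a : Fin n → ℝ) (x : Cube n) :
    linForm (c • a) x = c * linForm a x := by
  simp only [linForm, Pi.smul_apply, smul_eq_mul, mul_assoc, mul_sum]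

theorem linForm_flip (a : Fin n → ℝ) (k : Fin n) (x : Cube n) :
    linForm a (flip k x) = linForm a x - 2 * (a k * sgn (x k)) := by
  have hsum : ∑ j ∈ univ.erase k, a j * sgn (flip k x j) = ∑ j ∈ univ.erase k, a j * sgn (x j) :=
    sum_congr rfl fun j hj => by rw [flip_apply_of_ne (ne_of_mem_erase hj)]
  rw [linForm, linForm, ← add_sum_erase univ _ (mem_univ k), hsum,
    ← add_sum_erase univ (fun j => a j * sgn (x j)) (mem_univ k), flip_apply_self, sgn_not]
  ring

theorem expect_mul_linForm (f : Cube n → ℝ) (a : Fin n → ℝ) :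
    expect (fun x => f x * linForm a x) = ∑ j, a j * expect (discDeriv j f) := by
  simp only [linForm, mul_sum, mul_left_comm (f _), expect_sum, expect_const_mul, expect_mul_sgn]

theorem expect_linForm (a : Fin n → ℝ) : expect (linForm a) = 0 := by
  have h := expect_mul_linForm (fun _ => 1) a
  simp only [one_mul, funext (discDeriv_const _ 1), expect_const, mul_zero, sum_const_zero] at h
  exact h

theorem expect_exp_linForm (a : Fin n → ℝ) :
    expect (fun x => Real.exp (linForm a x)) = ∏ j, Real.cosh (a j) := by
  simp only [linForm, Real.exp_sum]
  rw [expect_prod fun j b => Real.exp (a j * sgn b)]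
  simp only [sgn_true, sgn_false, mul_one, mul_neg, Real.cosh_eq]

theorem expect_exp_mul_linForm_le {a : Fin n → ℝ} {v : ℝ} (ha : ∑ j, a j ^ 2 ≤ v) (c : ℝ) :
    expect (fun x => Real.exp (c * linForm a x)) ≤ Real.exp (c ^ 2 * v / 2) := by
  simp only [← linForm_smul, expect_exp_linForm]
  calc ∏ j, Real.cosh ((c • a) j) ≤ ∏ j, Real.exp ((c • a) j ^ 2 / 2) :=
        prod_le_prod (fun j _ => (Real.cosh_pos _).le) fun j _ => Real.cosh_le_exp_half_sq _
    _ = Real.exp (c ^ 2 * (∑ j, a j ^ 2) / 2) := by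
        rw [← Real.exp_sum, ← sum_div, mul_sum]
        simp only [Pi.smul_apply, smul_eq_mul, mul_pow]
    _ ≤ Real.exp (c ^ 2 * v / 2) := by gcongr

/-- An exponential form of Hoeffding's inequality: the integrand is at least `1` where
`t ≤ |linForm a|`. -/
theorem expect_exp_abs_linForm_sub_le {a : Fin n → ℝ} {v : ℝ} (ha : ∑ j, a j ^ 2 ≤ v)
    (hv : 0 < v) (t : ℝ) :
    expect (fun x => Real.exp (t / v * (|linForm a x| - t))) ≤
      2 * Real.exp (-(t ^ 2 / (2 * v))) := by
  have split (x : Cube n) : Real.exp (t / v * (|linForm a x| - t)) ≤ Real.exp (-(t ^ 2 / v)) *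
      (Real.exp (t / v * linForm a x) + Real.exp (-(t / v) * linForm a x)) := by
    have e : t / v * (|linForm a x| - t) = -(t ^ 2 / v) + t / v * |linForm a x| := by
      ring
    rw [e, Real.exp_add]
    gcongr
    rcases abs_choice (linForm a x) with h | h <;> rw [h]
    · exact le_add_of_nonneg_right (Real.exp_pos _).le
    · rw [mul_neg, ← neg_mul]
      exact le_add_of_nonneg_left (Real.exp_pos _).le
  refine (expect_mono split).trans ?_
  rw [expect_const_mul, expect_add]
  have hpos := expect_exp_mul_linForm_le ha (t / v)
  have hneg := expect_exp_mul_linForm_le ha (-(t / v))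
  rw [neg_sq] at hneg
  have e : -(t ^ 2 / (2 * v)) = -(t ^ 2 / v) + (t / v) ^ 2 * v / 2 := by
    field_simp
    ring
  rw [e, Real.exp_add, mul_left_comm, two_mul (Real.exp _)]
  gcongr

/-- This becomes the level-one inequality for `K = √(2 * log (M / E|φ|))`. -/
theorem expect_mul_linForm_le {φ : Cube n → ℝ} {M : ℝ} (hφ : ∀ x, |φ x| ≤ M) {a : Fin n → ℝ}
    (ha : ∑ j, a j ^ 2 ≤ 1) {K : ℝ} (hK : 1 ≤ K) :
    expect (fun x => φ x * linForm a x) ≤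
      K * expect (fun x => |φ x|) + 2 * M * Real.exp (-(K ^ 2 / 2)) := by
  have hM : 0 ≤ M := (abs_nonneg _).trans (hφ fun _ => true)
  have truncate (x : Cube n) : φ x * linForm a x ≤
      K * |φ x| + M * Real.exp (K / 1 * (|linForm a x| - K)) := by
    have htail : |linForm a x| - K ≤ Real.exp (K / 1 * (|linForm a x| - K)) := by
      rw [div_one]
      rcases le_total (|linForm a x|) K with h | h
      · exact (sub_nonpos.2 h).trans (Real.exp_pos _).le
      · have := Real.add_one_le_exp (K * (|linForm a x| - K))
        nlinarith
    calc φ x * linForm a x ≤ |φ x| * |linForm a x| := by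
          rw [← abs_mul]
          exact le_abs_self _
      _ = K * |φ x| + |φ x| * (|linForm a x| - K) := by ring
      _ ≤ K * |φ x| + |φ x| * Real.exp (K / 1 * (|linForm a x| - K)) := by gcongr
      _ ≤ K * |φ x| + M * Real.exp (K / 1 * (|linForm a x| - K)) := by
          gcongr
          exact hφ x
  refine (expect_mono truncate).trans ?_
  rw [expect_add, expect_const_mul, expect_const_mul, mul_comm 2 M, mul_assoc M]
  have := expect_exp_abs_linForm_sub_le ha one_pos K
  rw [mul_one] at this
  gcongr

theorem noise_prod_sgn (ρ : Fin n → ℝ) (s : Finset (Fin n)) (y : Cube n) :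
    noise ρ (fun x => ∏ j ∈ s, sgn (x j)) y = ∏ j ∈ s, ρ j * sgn (y j) := by
  have hprod (x : Cube n) : (∏ j ∈ s, sgn (x j)) * kernel ρ x y =
      ∏ j, (if j ∈ s then sgn (x j) else 1) * (1 + ρ j * (sgn (x j) * sgn (y j))) := by
    rw [kernel, prod_mul_distrib, Fintype.prod_ite_mem]
  simp only [noise, hprod]
  rw [expect_prod fun j b => (if j ∈ s then sgn b else 1) * (1 + ρ j * (sgn b * sgn (y j))),
    ← Fintype.prod_ite_mem s fun j => ρ j * sgn (y j)]
  refine prod_congr rfl fun j _ => ?_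
  split_ifs <;> simp only [sgn_true, sgn_false] <;> ring

theorem noise_const (ρ : Fin n → ℝ) (c : ℝ) (y : Cube n) : noise ρ (fun _ => c) y = c := by
  have h := noise_prod_sgn ρ ∅ y
  simp only [prod_empty, noise, one_mul] at h
  rw [noise, expect_const_mul, h, mul_one]

theorem noise_const_mul (ρ : Fin n → ℝ) (c : ℝ) (f : Cube n → ℝ) (y : Cube n) :
    noise ρ (fun x => c * f x) y = c * noise ρ f y := by
  simp only [noise, mul_assoc, expect_const_mul]

theorem noise_sub (ρ : Fin n → ℝ) (f g : Cube n → ℝ) (y : Cube n) :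
    noise ρ (fun x => f x - g x) y = noise ρ f y - noise ρ g y := by
  simp only [noise, sub_mul, expect_sub]

theorem noise_mono {ρ : Fin n → ℝ} (h : ∀ j, ρ j ∈ Set.Icc (0 : ℝ) 1) {f g : Cube n → ℝ}
    (hfg : ∀ x, f x ≤ g x) (y : Cube n) : noise ρ f y ≤ noise ρ g y :=
  expect_mono fun x => mul_le_mul_of_nonneg_right (hfg x) (kernel_nonneg h x y)

theorem noise_sgn_mul_sgn_of_ne (ρ : Fin n → ℝ) {i j : Fin n} (hij : i ≠ j) (y : Cube n) :
    noise ρ (fun x => sgn (x i) * sgn (x j)) y = ρ i * sgn (y i) * (ρ j * sgn (y j)) := by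
  simpa only [prod_pair hij] using noise_prod_sgn ρ {i, j} y

/-- The right-hand side exceeds the left-hand side by the diagonal terms `∑ j, (a j * ρ j) ^ 2`. -/
theorem noise_sq_linForm_le (ρ a : Fin n → ℝ) (y : Cube n) :
    noise ρ (fun x => linForm a x ^ 2) y ≤
      ∑ j, a j ^ 2 + linForm (fun j => a j * ρ j) y ^ 2 := by
  have expand : noise ρ (fun x => linForm a x ^ 2) y =
      ∑ i, ∑ j, a i * a j * noise ρ (fun x => sgn (x i) * sgn (x j)) y := by
    simp only [noise, ← expect_const_mul, ← expect_sum]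
    congr 1
    funext x
    rw [linForm, sq, sum_mul_sum, sum_mul]
    refine sum_congr rfl fun i _ => ?_
    rw [sum_mul]
    exact sum_congr rfl fun j _ => by ring
  have entry (i j : Fin n) : a i * a j * noise ρ (fun x => sgn (x i) * sgn (x j)) y ≤
      (if i = j then a i ^ 2 else 0) + a i * ρ i * sgn (y i) * (a j * ρ j * sgn (y j)) := by
    rcases eq_or_ne i j with rfl | hij
    · simp only [sgn_mul_self, noise_const, if_true]
      nlinarith [sq_nonneg (a i * ρ i * sgn (y i))]
    · rw [noise_sgn_mul_sgn_of_ne ρ hij, if_neg hij]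
      exact le_of_eq (by ring)
  calc noise ρ (fun x => linForm a x ^ 2) y
      ≤ ∑ i, ∑ j, ((if i = j then a i ^ 2 else 0) +
          a i * ρ i * sgn (y i) * (a j * ρ j * sgn (y j))) := by
        rw [expand]
        gcongr
        exact entry _ _
    _ = _ := by
        simp only [sum_add_distrib, sum_ite_eq, mem_univ, if_true, ← mul_sum, ← sum_mul, linForm,
          sq]

theorem expect_sq_linForm_le (a : Fin n → ℝ) :
    expect (fun x => linForm a x ^ 2) ≤ ∑ j, a j ^ 2 := by
  simpa [noise, kernel, linForm] using noise_sq_linForm_le 0 a fun _ => true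

/-! ### The clipped normalized sum -/

theorem linForm_mono {a : Fin n → ℝ} (ha : ∀ j, 0 ≤ a j) : Monotone (linForm a) := by
  intro x y hxy
  exact sum_le_sum fun j _ => mul_le_mul_of_nonneg_left (sgn_mono (hxy j)) (ha j)

/-- The sum of the coordinates in the `±1` convention, divided by its standard deviation `√n`. Its
superlevel sets are the symmetric half-spaces. -/
noncomputable def normSum : Cube n → ℝ := linForm fun _ => (√n)⁻¹

theorem normSum_mono : Monotone (normSum (n := n)) :=
  linForm_mono fun _ => by positivity

theorem normSum_symm : FullySymmetricFun (normSum (n := n)) := fun σ x =>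
  Equiv.sum_comp σ fun j => (√(n : ℝ))⁻¹ * sgn (x j)

theorem sum_inv_sqrt_sq_le_one : ∑ _j : Fin n, (√(n : ℝ))⁻¹ ^ 2 ≤ 1 := by
  rw [sum_const, card_univ, Fintype.card_fin, nsmul_eq_mul, inv_pow, Real.sq_sqrt n.cast_nonneg]
  exact mul_inv_le_one

/-- The bounded function with which symmetric increasing functions are compared: the normalized sum,
truncated to `[-1, 1]` after a scaling which makes truncation rare. -/
noncomputable def clip (x : Cube n) : ℝ := max (-1) (min 1 (normSum x / 4))

theorem clip_mem (x : Cube n) : clip x ∈ Set.Icc (-1 : ℝ) 1 :=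
  ⟨le_max_left _ _, max_le (by norm_num) (min_le_left _ _)⟩

theorem clip_mono : Monotone (clip (n := n)) := fun x y h => by
  unfold clip
  gcongr
  exact normSum_mono h

theorem clip_symm : FullySymmetricFun (clip (n := n)) := fun σ x => by
  rw [clip, clip, normSum_symm]

theorem clip_of_sq_le {x : Cube n} (h : normSum x ^ 2 ≤ 4 ^ 2) : clip x = normSum x / 4 := by
  obtain ⟨lower, upper⟩ := abs_le_of_sq_le_sq' h (by norm_num)
  rw [clip, min_eq_right (by linarith), max_eq_right (by linarith)]

theorem inv_sqrt_mul_le_discDeriv_clip (k : Fin n) (x : Cube n) :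
    (√n)⁻¹ / 4 - (√n)⁻¹ / 16 * normSum x ^ 2 ≤ discDeriv k clip x := by
  have hinv0 : 0 ≤ (√(n : ℝ))⁻¹ := by positivity
  have hinv1 : (√(n : ℝ))⁻¹ ≤ 1 :=
    inv_le_one_of_one_le₀ (Real.one_le_sqrt.2 (by exact_mod_cast k.pos))
  rcases le_or_gt (normSum x ^ 2) (2 ^ 2) with h | h
  · have hflip : normSum (flip k x) = normSum x - 2 * ((√n)⁻¹ * sgn (x k)) := linForm_flip ..
    have hflip_sq : normSum (flip k x) ^ 2 ≤ 4 ^ 2 := by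
      obtain ⟨lower, upper⟩ := abs_le_of_sq_le_sq' h (by norm_num)
      rw [hflip]
      cases x k <;> simp only [sgn_true, sgn_false] <;> apply sq_le_sq' <;> linarith
    have hderiv : discDeriv k clip x = (√n)⁻¹ / 4 := by
      rw [discDeriv, clip_of_sq_le (h.trans (by norm_num)), clip_of_sq_le hflip_sq, hflip]
      linear_combination (√n)⁻¹ / 4 * sgn_mul_self (x k)
    rw [hderiv]
    exact sub_le_self _ (by positivity)
  · refine le_trans ?_ (discDeriv_nonneg clip_mono k x)
    nlinarith

/-- The linear form in `hy` is the conditional expectation of `normSum x` given `y`. -/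
theorem inv_sqrt_le_noise_discDeriv_clip {ρ : Fin n → ℝ} (hρ : ∀ j, ρ j ∈ Set.Icc (0 : ℝ) 1)
    (k : Fin n) {y : Cube n} (hy : |linForm (fun j => (√n)⁻¹ * ρ j) y| ≤ 1) :
    (√n)⁻¹ / 8 ≤ noise ρ (discDeriv k clip) y := by
  have second_moment : noise ρ (fun x => normSum x ^ 2) y ≤ 2 :=
    calc noise ρ (fun x => normSum x ^ 2) y
        ≤ ∑ _j : Fin n, (√(n : ℝ))⁻¹ ^ 2 + linForm (fun j => (√n)⁻¹ * ρ j) y ^ 2 :=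
          noise_sq_linForm_le ..
      _ ≤ 1 + 1 := add_le_add sum_inv_sqrt_sq_le_one ((sq_le_one_iff_abs_le_one _).2 hy)
      _ = 2 := by norm_num
  refine le_trans ?_ (noise_mono hρ (inv_sqrt_mul_le_discDeriv_clip k) y)
  rw [noise_sub, noise_const, noise_const_mul]
  nlinarith [inv_nonneg.2 (Real.sqrt_nonneg (n : ℝ))]

theorem sum_sq_inv_sqrt_mul_le {r : ℝ} {ρ : Fin n → ℝ} (hρ : ∀ j, ρ j ∈ Set.Icc 0 r) :
    ∑ j, ((√n)⁻¹ * ρ j) ^ 2 ≤ r ^ 2 :=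
  calc ∑ j, ((√n)⁻¹ * ρ j) ^ 2 ≤ ∑ _j : Fin n, (√(n : ℝ))⁻¹ ^ 2 * r ^ 2 := by
        simp only [mul_pow]
        gcongr with j
        exacts [(hρ j).1, (hρ j).2]
    _ ≤ r ^ 2 := by
        rw [← sum_mul]
        exact mul_le_of_le_one_left (sq_nonneg r) sum_inv_sqrt_sq_le_one

theorem inv_sqrt_mul_le_corr_discDeriv_clip {g : Cube n → ℝ} (hg : Monotone g)
    (hg1 : ∀ x, g x ∈ Set.Icc (-1 : ℝ) 1) (k : Fin n) {r : ℝ} (hr0 : 0 < r) (hr1 : r ≤ 1)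
    {ρ : Fin n → ℝ} (hρ : ∀ j, ρ j ∈ Set.Icc 0 r) :
    (√n)⁻¹ / 8 * (expect (discDeriv k g) - 2 * Real.exp (-(1 / (2 * r ^ 2)))) ≤
      corr ρ (discDeriv k clip) (discDeriv k g) := by
  have hρ1 (j : Fin n) : ρ j ∈ Set.Icc (0 : ℝ) 1 := ⟨(hρ j).1, (hρ j).2.trans hr1⟩
  set a : Fin n → ℝ := fun j => (√n)⁻¹ * ρ j
  have htail := expect_exp_abs_linForm_sub_le (sum_sq_inv_sqrt_mul_le hρ) (by positivity) 1
  rw [one_pow] at htail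
  have pointwise (y : Cube n) : (√n)⁻¹ / 8 *
      (discDeriv k g y - Real.exp (1 / r ^ 2 * (|linForm a y| - 1))) ≤
        noise ρ (discDeriv k clip) y * discDeriv k g y := by
    rcases le_or_gt |linForm a y| 1 with hy | hy
    · have hderiv := discDeriv_nonneg hg k y
      calc (√n)⁻¹ / 8 * (discDeriv k g y - Real.exp (1 / r ^ 2 * (|linForm a y| - 1)))
          ≤ (√n)⁻¹ / 8 * discDeriv k g y := by
            gcongr
            exact sub_le_self _ (Real.exp_pos _).le
        _ ≤ noise ρ (discDeriv k clip) y * discDeriv k g y := by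
            gcongr
            exact inv_sqrt_le_noise_discDeriv_clip hρ1 k hy
    · have hexp : 1 ≤ Real.exp (1 / r ^ 2 * (|linForm a y| - 1)) :=
        Real.one_le_exp (mul_nonneg (by positivity) (by linarith))
      have hle := discDeriv_le_one hg1 k y
      refine le_trans (mul_nonpos_of_nonneg_of_nonpos (by positivity) (by linarith)) ?_
      exact mul_nonneg (noise_nonneg hρ1 (discDeriv_nonneg clip_mono k) y)
        (discDeriv_nonneg hg k y)
  calc (√n)⁻¹ / 8 * (expect (discDeriv k g) - 2 * Real.exp (-(1 / (2 * r ^ 2))))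
      ≤ (√n)⁻¹ / 8 * (expect (discDeriv k g) -
          expect fun y => Real.exp (1 / r ^ 2 * (|linForm a y| - 1))) := by gcongr
    _ = expect fun y => (√n)⁻¹ / 8 *
          (discDeriv k g y - Real.exp (1 / r ^ 2 * (|linForm a y| - 1))) := by
        rw [expect_const_mul, expect_sub]
    _ ≤ corr ρ (discDeriv k clip) (discDeriv k g) := expect_mono pointwise

theorem one_le_log_exp_pow_div {t : ℝ} {p : ℕ} (ht : 0 < t) (htp : t ≤ Real.exp 1 ^ p) :
    1 ≤ Real.log (Real.exp 1 ^ (p + 1) / t) := by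
  rw [Real.le_log_iff_exp_le (by positivity), le_div_iff₀ ht, pow_succ']
  gcongr

theorem one_le_log_exp_sq_div_influenceFun {g : Cube n → ℝ} (hg : Monotone g)
    (hg1 : ∀ x, g x ∈ Set.Icc (-1 : ℝ) 1) {k : Fin n} (hpos : 0 < influenceFun g k) :
    1 ≤ Real.log (Real.exp 1 ^ 2 / influenceFun g k) :=
  one_le_log_exp_pow_div hpos (by
    linarith [influenceFun_le_two hg hg1 k, Real.add_one_le_exp 1, pow_one (Real.exp 1)])

theorem exp_neg_two_mul_log_exp_sq_div_le {t : ℝ} (ht : 0 < t) (ht2 : t ≤ 2) :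
    Real.exp (-(2 * Real.log (Real.exp 1 ^ 2 / t))) ≤ t / 8 := by
  have hexp : Real.exp (-(2 * Real.log (Real.exp 1 ^ 2 / t))) = t * (t / Real.exp 1 ^ 4) := by
    rw [two_mul, neg_add, Real.exp_add, Real.exp_neg, Real.exp_log (by positivity)]
    field_simp
  have h16 : (2 : ℝ) ^ 4 ≤ Real.exp 1 ^ 4 := by
    gcongr
    linarith [Real.add_one_le_exp 1]
  rw [hexp, div_eq_mul_inv t 8]
  refine mul_le_mul_of_nonneg_left ?_ ht.le
  rw [div_le_iff₀ (by positivity)]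
  linarith

theorem influenceFun_div_sqrt_log_le_mul_corr {g : Cube n → ℝ} (hg : Monotone g)
    (hg1 : ∀ x, g x ∈ Set.Icc (-1 : ℝ) 1) (k : Fin n) {r : ℝ}
    (hr : r = (2 * √(Real.log (Real.exp 1 ^ 2 / influenceFun g k)))⁻¹) (hr1 : r ≤ 1)
    {ρ : Fin n → ℝ} (hρ : ∀ j, ρ j ∈ Set.Icc 0 r) :
    (√n)⁻¹ / 64 * (influenceFun g k / √(Real.log (Real.exp 1 ^ 2 / influenceFun g k))) ≤
      r * corr ρ (discDeriv k clip) (discDeriv k g) := by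
  set L := Real.log (Real.exp 1 ^ 2 / influenceFun g k)
  rcases (influenceFun_nonneg g k).eq_or_lt with hzero | hpos
  · rw [← hzero, zero_div, mul_zero]
    have hr0 : 0 ≤ r := hr ▸ by positivity
    exact mul_nonneg hr0 (corr_nonneg (fun j => ⟨(hρ j).1, (hρ j).2.trans hr1⟩)
      (discDeriv_nonneg clip_mono k) (discDeriv_nonneg hg k))
  · have hL1 : 1 ≤ L := one_le_log_exp_sq_div_influenceFun hg hg1 hpos
    have : 0 < √L := by positivity
    have hr0 : 0 < r := hr ▸ by positivity
    have hexponent : 1 / (2 * r ^ 2) = 2 * L := by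
      rw [hr, inv_pow, mul_pow, Real.sq_sqrt (by linarith)]
      field_simp
    have htail : Real.exp (-(1 / (2 * r ^ 2))) ≤ influenceFun g k / 8 := by
      rw [hexponent]
      exact exp_neg_two_mul_log_exp_sq_div_le hpos (influenceFun_le_two hg hg1 k)
    calc (√n)⁻¹ / 64 * (influenceFun g k / √L)
        = r * ((√n)⁻¹ / 8 * (influenceFun g k / 4)) := by
          rw [hr]
          field_simp
          norm_num
      _ ≤ r * ((√n)⁻¹ / 8 *
            (expect (discDeriv k g) - 2 * Real.exp (-(1 / (2 * r ^ 2))))) := by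
          gcongr
          linarith [influenceFun_eq_two_mul hg k]
      _ ≤ r * corr ρ (discDeriv k clip) (discDeriv k g) := by
          gcongr
          exact inv_sqrt_mul_le_corr_discDeriv_clip hg hg1 k hr0 hr1 hρ

theorem sum_influenceFun_div_sqrt_log_le_covFun_clip {g : Cube n → ℝ} (hg : Monotone g)
    (hg1 : ∀ x, g x ∈ Set.Icc (-1 : ℝ) 1) :
    (√n)⁻¹ / 64 * ∑ i, influenceFun g i / √(Real.log (Real.exp 1 ^ 2 / influenceFun g i)) ≤
      covFun clip g := by
  set R : Fin n → ℝ := fun k => (2 * √(Real.log (Real.exp 1 ^ 2 / influenceFun g k)))⁻¹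
  have hR0 (k : Fin n) : 0 ≤ R k := by positivity
  have hR1 (k : Fin n) : R k ≤ 1 := by
    rcases (influenceFun_nonneg g k).eq_or_lt with hzero | hpos
    · simp [R, ← hzero]
    · have := Real.one_le_sqrt.2 (one_le_log_exp_sq_div_influenceFun hg hg1 hpos)
      exact inv_le_one_of_one_le₀ (by linarith)
  have hraise := corr_zero_add_sum_le hR0 fun k ρ hρ =>
    influenceFun_div_sqrt_log_le_mul_corr hg hg1 k rfl (hR1 k) hρ
  have hmono := corr_mono clip_mono hg hR0 (τ := 1) hR1 fun _ => le_rfl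
  rw [covFun_eq_corr_sub, mul_sum]
  linarith

/-! ### Symmetric functions -/

theorem exists_perm_comp_le {x y : Cube n} (h : #{i | y i = true} ≤ #{i | x i = true}) :
    ∃ σ : Equiv.Perm (Fin n), y ∘ σ ≤ x := by
  obtain ⟨T, hT, hcard⟩ := exists_subset_card_eq h
  have e : {i // i ∈ T} ≃ {i // y i = true} := by
    refine Fintype.equivOfCardEq ?_
    rw [Fintype.card_coe, hcard, Fintype.card_subtype]
  refine ⟨e.extendSubtype, fun i => ?_⟩
  by_cases hi : i ∈ T
  · rw [(mem_filter_univ i).1 (hT hi)]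
    exact Bool.le_true _
  · rw [Function.comp_apply, Bool.eq_false_iff.2 (Equiv.extendSubtype_not_mem e i hi)]
    exact Bool.false_le _

theorem le_of_card_le {f : Cube n → ℝ} (hf : Monotone f) (hs : FullySymmetricFun f)
    {x y : Cube n} (h : #{i | y i = true} ≤ #{i | x i = true}) : f y ≤ f x := by
  obtain ⟨σ, hσ⟩ := exists_perm_comp_le h
  rw [← hs σ y]
  exact hf hσ

theorem monovary_of_fullySymmetricFun {f g : Cube n → ℝ} (hf : Monotone f)
    (hfs : FullySymmetricFun f) (hg : Monotone g) (hgs : FullySymmetricFun g) :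
    Monovary f g := fun _ _ hxy =>
  le_of_card_le hf hfs <| (le_total _ _).resolve_right fun h =>
    (le_of_card_le hg hgs h).not_gt hxy

/-- The average of a function over all permutations of the coordinates, which has the same
covariance with every fully symmetric function. -/
noncomputable def symmetrize (g : Cube n → ℝ) (x : Cube n) : ℝ :=
  (∑ σ : Equiv.Perm (Fin n), g (x ∘ σ)) / Fintype.card (Equiv.Perm (Fin n))

theorem symmetrize_mono {g : Cube n → ℝ} (hg : Monotone g) : Monotone (symmetrize g) := by
  intro x y h
  unfold symmetrize
  gcongr with σ
  exact hg fun i => h (σ i)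

theorem symmetrize_symm (g : Cube n → ℝ) : FullySymmetricFun (symmetrize g) := by
  intro τ x
  unfold symmetrize
  congr 1
  exact Equiv.sum_comp (Equiv.mulLeft τ) fun σ : Equiv.Perm (Fin n) => g (x ∘ σ)

theorem expect_mul_symmetrize {f : Cube n → ℝ} (hf : FullySymmetricFun f) (g : Cube n → ℝ) :
    expect (fun x => f x * symmetrize g x) = expect fun x => f x * g x := by
  have average : (fun x => f x * symmetrize g x) = fun x =>
      (∑ σ : Equiv.Perm (Fin n), f (x ∘ σ) * g (x ∘ σ)) *
        (Fintype.card (Equiv.Perm (Fin n)) : ℝ)⁻¹ := by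
    funext x
    simp only [hf _ x, ← mul_sum, symmetrize]
    ring
  rw [average, expect_mul_const, expect_sum]
  simp only [expect_comp_perm _ fun x => f x * g x]
  rw [sum_const, card_univ, nsmul_eq_mul]
  have : (Fintype.card (Equiv.Perm (Fin n)) : ℝ) ≠ 0 := by
    exact_mod_cast Fintype.card_ne_zero
  field_simp

theorem covFun_symmetrize {f : Cube n → ℝ} (hf : FullySymmetricFun f) (g : Cube n → ℝ) :
    covFun f (symmetrize g) = covFun f g := by
  have hexpect := expect_mul_symmetrize (f := fun _ : Cube n => (1 : ℝ)) (fun _ _ => rfl) g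
  simp only [one_mul] at hexpect
  rw [covFun, covFun, expect_mul_symmetrize hf, hexpect]

theorem covFun_le_two_mul_expect_abs_sub {φ : Cube n → ℝ} (hφ : ∀ x, φ x ∈ Set.Icc (-1 : ℝ) 1)
    (g : Cube n → ℝ) (α : ℝ) : covFun φ g ≤ 2 * expect fun x => |g x - α| := by
  obtain ⟨lower, upper⟩ := expect_mem_Icc hφ
  rw [covFun_eq_expect φ g α, ← expect_const_mul]
  refine expect_mono fun x => (le_abs_self _).trans ?_
  rw [abs_mul]
  gcongr
  obtain ⟨lower', upper'⟩ := hφ x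
  exact abs_le.2 ⟨by linarith, by linarith⟩

/-- Both covariances only see the symmetrization of `g`, which varies together with `f`. -/
theorem exists_expect_abs_sub_mul_covFun_le {f φ g : Cube n → ℝ} (hf : Monotone f)
    (hfs : FullySymmetricFun f) (hφ : ∀ x, φ x ∈ Set.Icc (-1 : ℝ) 1)
    (hφs : FullySymmetricFun φ) (hg : Monotone g) :
    ∃ w, (expect fun x => |f x - f w|) * covFun φ g ≤ 2 * covFun f g := by
  obtain ⟨w, hw⟩ := exists_expect_abs_sub_mul_expect_abs_sub_le
    (monovary_of_fullySymmetricFun hf hfs (symmetrize_mono hg) (symmetrize_symm g))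
  refine ⟨w, ?_⟩
  rw [← covFun_symmetrize hfs g, ← covFun_symmetrize hφs g]
  have hcov := covFun_le_two_mul_expect_abs_sub hφ (symmetrize g) (symmetrize g w)
  have := mul_le_mul_of_nonneg_left hcov (expect_nonneg fun x => abs_nonneg (f x - f w))
  linarith

theorem flip_comp_perm (σ : Equiv.Perm (Fin n)) (k : Fin n) (x : Cube n) :
    flip k (x ∘ σ) = flip (σ k) x ∘ σ := by
  funext j
  rcases eq_or_ne j k with rfl | hj
  · simp only [flip_apply_self, Function.comp_apply]
  · rw [flip_apply_of_ne hj, Function.comp_apply, Function.comp_apply,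
      flip_apply_of_ne (σ.injective.ne hj)]

theorem influenceFun_perm {f : Cube n → ℝ} (hs : FullySymmetricFun f) (σ : Equiv.Perm (Fin n))
    (k : Fin n) : influenceFun f (σ k) = influenceFun f k := by
  unfold influenceFun
  rw [← expect_comp_perm σ fun x => |f x - f (flip k x)|]
  simp only [flip_comp_perm, hs σ]

theorem influenceFun_eq_of_fullySymmetricFun {f : Cube n → ℝ} (hs : FullySymmetricFun f)
    (i j : Fin n) : influenceFun f i = influenceFun f j := by
  rw [← influenceFun_perm hs (Equiv.swap i j) j, Equiv.swap_apply_right]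

theorem sqrt_mul_influenceFun {f : Cube n → ℝ} (hf : Monotone f) (hs : FullySymmetricFun f)
    (k : Fin n) : √n * influenceFun f k = 2 * expect fun x => f x * normSum x := by
  have hderiv (j : Fin n) : expect (discDeriv j f) = influenceFun f k / 2 := by
    rw [← influenceFun_eq_of_fullySymmetricFun hs j k, influenceFun_eq_two_mul hf]
    ring
  have hn : (0 : ℝ) < n := by exact_mod_cast k.pos
  simp only [normSum, expect_mul_linForm, hderiv, sum_const, card_univ, Fintype.card_fin,
    nsmul_eq_mul]
  field_simp
  rw [Real.sq_sqrt hn.le, mul_comm]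

theorem expect_sub_mul_normSum (f : Cube n → ℝ) (m : ℝ) :
    expect (fun x => (f x - m) * normSum x) = expect fun x => f x * normSum x := by
  simp only [sub_mul, expect_sub, expect_const_mul, normSum]
  rw [expect_linForm, mul_zero, sub_zero]

theorem sqrt_mul_influenceFun_le {f : Cube n → ℝ} (hf : Monotone f) (hs : FullySymmetricFun f)
    {a b : ℝ} (hab : ∀ x, f x ∈ Set.Icc a b) (k : Fin n) :
    √n * influenceFun f k ≤ b - a := by
  have hle : a ≤ b := (hab fun _ => true).1.trans (hab fun _ => true).2
  rw [sqrt_mul_influenceFun hf hs, ← expect_sub_mul_normSum f ((a + b) / 2)]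
  have hf2 : expect (fun x => (f x - (a + b) / 2) ^ 2) ≤ ((b - a) / 2) ^ 2 := by
    rw [← expect_const (n := n) (((b - a) / 2) ^ 2)]
    refine expect_mono fun x => ?_
    obtain ⟨lower, upper⟩ := hab x
    exact sq_le_sq' (by linarith) (by linarith)
  have hN2 : expect (fun x : Cube n => normSum x ^ 2) ≤ 1 :=
    (expect_sq_linForm_le _).trans sum_inv_sqrt_sq_le_one
  have cauchy_schwarz := (sq_expect_mul_le (fun x => f x - (a + b) / 2) normSum).trans
    (mul_le_mul hf2 hN2 (expect_nonneg fun x => sq_nonneg _) (sq_nonneg _))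
  rw [mul_one] at cauchy_schwarz
  linarith [abs_le_of_sq_le_sq' cauchy_schwarz (by linarith)]

theorem mul_exp_neg_two_mul_log_exp_cube_div_sq_le {s : ℝ} (hs : 0 < s) (hs2 : s ≤ 2) :
    16 * Real.exp (-(2 * Real.log (Real.exp 1 ^ 3 / s ^ 2))) ≤ s := by
  have hexp : 16 * Real.exp (-(2 * Real.log (Real.exp 1 ^ 3 / s ^ 2))) =
      s * (16 * s ^ 3 / Real.exp 1 ^ 6) := by
    rw [two_mul, neg_add, Real.exp_add, Real.exp_neg, Real.exp_log (by positivity)]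
    field_simp
  have hs3 : s ^ 3 ≤ 2 ^ 3 := by gcongr
  have he6 : (2.7 : ℝ) ^ 6 ≤ Real.exp 1 ^ 6 := by
    gcongr
    linarith [Real.exp_one_gt_d9]
  rw [hexp]
  refine mul_le_of_le_one_right hs.le ?_
  rw [div_le_one (by positivity)]
  linarith

/-- The level-one inequality for `f - m`, truncated at the height `K` for which its error term is at
most half of `√n * influenceFun f k`. -/
theorem influenceFun_div_sqrt_log_le {f : Cube n → ℝ} (hf : Monotone f)
    (hs : FullySymmetricFun f) (hf1 : ∀ x, f x ∈ Set.Icc (-1 : ℝ) 1) (k : Fin n) {m : ℝ}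
    (hm : m ∈ Set.Icc (-1 : ℝ) 1) :
    influenceFun f k / √(Real.log (Real.exp 1 ^ 3 / (n * influenceFun f k ^ 2))) ≤
      8 * (√n)⁻¹ * expect fun x => |f x - m| := by
  have hV : 0 ≤ expect fun x => |f x - m| := expect_nonneg fun x => abs_nonneg _
  have hn : (0 : ℝ) < n := by exact_mod_cast k.pos
  rcases (influenceFun_nonneg f k).eq_or_lt with hzero | hpos
  · rw [← hzero, zero_div]
    positivity
  set s := √n * influenceFun f k with hs_def
  have hns : n * influenceFun f k ^ 2 = s ^ 2 := by rw [hs_def, mul_pow, Real.sq_sqrt hn.le]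
  have hspos : 0 < s := by positivity
  have hs2 : s ≤ 2 := (sqrt_mul_influenceFun_le hf hs hf1 k).trans (by norm_num)
  rw [hns]
  set L := Real.log (Real.exp 1 ^ 3 / s ^ 2)
  have hL1 : 1 ≤ L := one_le_log_exp_pow_div (by positivity) (by
    gcongr
    linarith [Real.add_one_le_exp 1])
  have hK : 1 ≤ 2 * √L := by linarith [Real.one_le_sqrt.2 hL1]
  have hf2 (x : Cube n) : |f x - m| ≤ 2 :=
    abs_le.2 ⟨by linarith [(hf1 x).1, hm.2], by linarith [(hf1 x).2, hm.1]⟩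
  have hlevel : s ≤ 2 * (2 * √L * (expect fun x => |f x - m|) +
      2 * 2 * Real.exp (-((2 * √L) ^ 2 / 2))) := by
    rw [hs_def, sqrt_mul_influenceFun hf hs, ← expect_sub_mul_normSum f m]
    gcongr
    exact expect_mul_linForm_le hf2 sum_inv_sqrt_sq_le_one hK
  have herror : 16 * Real.exp (-((2 * √L) ^ 2 / 2)) ≤ s := by
    have hsq : (2 * √L) ^ 2 / 2 = 2 * L := by
      rw [mul_pow, Real.sq_sqrt (by linarith)]
      ring
    rw [hsq]
    exact mul_exp_neg_two_mul_log_exp_cube_div_sq_le hspos hs2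
  calc influenceFun f k / √L = (√n)⁻¹ * (s / √L) := by
        rw [hs_def]
        field_simp
    _ ≤ (√n)⁻¹ * (8 * expect fun x => |f x - m|) := by
        gcongr
        rw [div_le_iff₀ (by linarith)]
        linarith
    _ = _ := by ring

theorem sum_influenceFun_mul_influenceFun_le_covFun {f g : Cube n → ℝ}
    (hf1 : ∀ x, f x ∈ Set.Icc (-1 : ℝ) 1) (hg1 : ∀ x, g x ∈ Set.Icc (-1 : ℝ) 1)
    (hf : Monotone f) (hg : Monotone g) (hs : FullySymmetricFun f) :
    1 / 1024 * ∑ i, (influenceFun f i / √(Real.log (Real.exp 1 ^ 3 /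
      (n * influenceFun f i ^ 2)))) *
        (influenceFun g i / √(Real.log (Real.exp 1 ^ 2 / influenceFun g i))) ≤ covFun f g := by
  obtain ⟨w, hw⟩ := exists_expect_abs_sub_mul_covFun_le hf hs clip_mem clip_symm hg
  have hV := expect_nonneg fun x => abs_nonneg (f x - f w)
  set V := expect fun x => |f x - f w|
  set ψ : Fin n → ℝ := fun i =>
    influenceFun g i / √(Real.log (Real.exp 1 ^ 2 / influenceFun g i))
  have hψ (i : Fin n) : 0 ≤ ψ i := div_nonneg (influenceFun_nonneg g i) (Real.sqrt_nonneg _)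
  have hclip : (√n)⁻¹ / 64 * ∑ i, ψ i ≤ covFun clip g :=
    sum_influenceFun_div_sqrt_log_le_covFun_clip hg hg1
  calc _ ≤ 1 / 1024 * ∑ i, 8 * (√n)⁻¹ * V * ψ i := by
        gcongr with i
        · exact hψ i
        · exact influenceFun_div_sqrt_log_le hf hs hf1 i (hf1 w)
    _ = V * ((√n)⁻¹ / 64 * ∑ i, ψ i) / 2 := by
        rw [← mul_sum]
        ring
    _ ≤ V * covFun clip g / 2 := by gcongr
    _ ≤ covFun f g := by linarith

/-! ### Families and their indicators -/

/-- The indicator function of a family, through which families are treated as functions. -/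
noncomputable def ind (A : Finset (Cube n)) (x : Cube n) : ℝ := if x ∈ A then 1 else 0

theorem ind_of_mem {A : Finset (Cube n)} {x : Cube n} (hx : x ∈ A) : ind A x = 1 := if_pos hx

theorem ind_of_notMem {A : Finset (Cube n)} {x : Cube n} (hx : x ∉ A) : ind A x = 0 := if_neg hx

theorem ind_mem (A : Finset (Cube n)) (x : Cube n) : ind A x ∈ Set.Icc (0 : ℝ) 1 := by
  unfold ind
  split_ifs <;> simp

theorem ind_compl (A : Finset (Cube n)) (x : Cube n) : ind Aᶜ x = 1 - ind A x := by
  by_cases hx : x ∈ A <;> simp [ind, hx]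

theorem expect_ind (A : Finset (Cube n)) : expect (ind A) = mu A := by
  simp [expect, ind, mu]

theorem mu_mem (A : Finset (Cube n)) : mu A ∈ Set.Icc (0 : ℝ) 1 := by
  rw [← expect_ind]
  exact expect_mem_Icc (ind_mem A)

theorem mu_compl (A : Finset (Cube n)) : mu Aᶜ = 1 - mu A := by
  rw [← expect_ind, funext (ind_compl A), expect_sub, expect_const, expect_ind]

theorem inv_two_pow_le_mu {A : Finset (Cube n)} (h : A.Nonempty) : ((2 : ℝ) ^ n)⁻¹ ≤ mu A := by
  rw [mu, inv_eq_one_div]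
  gcongr
  exact_mod_cast h.card_pos

/-! ### Tails of linear forms from below -/

theorem exp_sq_div_three_le_cosh {u : ℝ} (hu : u ^ 2 ≤ 1) :
    Real.exp (u ^ 2 / 3) ≤ Real.cosh u := by
  have hsinh : (u / 2) ^ 2 ≤ Real.sinh (u / 2) ^ 2 := by
    rw [sq_le_sq, Real.abs_sinh]
    exact Real.self_le_sinh_iff.2 (abs_nonneg _)
  have hcosh : Real.cosh u = 1 + 2 * Real.sinh (u / 2) ^ 2 := by
    rw [← mul_div_cancel₀ u (two_ne_zero' ℝ), Real.cosh_two_mul, Real.cosh_sq,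
      mul_div_cancel₀ u two_ne_zero]
    ring
  calc Real.exp (u ^ 2 / 3) ≤ 1 / (1 - u ^ 2 / 3) :=
        Real.exp_bound_div_one_sub_of_interval (by positivity) (by linarith)
    _ ≤ 1 + u ^ 2 / 2 := by
        rw [div_le_iff₀ (by linarith)]
        nlinarith only [hu, sq_nonneg u]
    _ ≤ Real.cosh u := by
        rw [hcosh]
        linarith

theorem exp_sum_sq_div_three_le_expect_exp_linForm {a : Fin n → ℝ} (ha : ∀ j, a j ^ 2 ≤ 1) :
    Real.exp ((∑ j, a j ^ 2) / 3) ≤ expect fun x => Real.exp (linForm a x) := by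
  rw [expect_exp_linForm, sum_div, Real.exp_sum]
  exact prod_le_prod (fun j _ => (Real.exp_pos _).le) fun j _ => exp_sq_div_three_le_cosh (ha j)

theorem two_mul_exp_le_expect_exp_mul_linForm {a : Fin n → ℝ} (ha : ∑ j, a j ^ 2 = 1) {z : ℝ}
    (hz : 1 ≤ z) (haz : ∀ j, (4 * z * a j) ^ 2 ≤ 1) :
    2 * Real.exp (4 * z ^ 2) ≤ expect fun x => Real.exp (4 * z * linForm a x) := by
  have h := exp_sum_sq_div_three_le_expect_exp_linForm (a := (4 * z) • a) haz
  simp only [linForm_smul, Pi.smul_apply, smul_eq_mul, mul_pow, ← mul_sum, ha] at h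
  refine le_trans ?_ h
  have hexp : (4 ^ 2 * z ^ 2 * 1) / 3 = 4 / 3 * z ^ 2 + 4 * z ^ 2 := by ring
  rw [hexp, Real.exp_add]
  gcongr
  nlinarith [Real.add_one_le_exp (4 / 3 * z ^ 2)]

/-- By the Cauchy–Schwarz inequality for `exp (4 * z * L)` with `L` the linear form: at most half of
its mean comes from the complement of `U`. -/
theorem exp_le_mu_of_sq_le {a : Fin n → ℝ} (ha : ∑ j, a j ^ 2 = 1) {z : ℝ} (hz : 1 ≤ z)
    (haz : ∀ j, (4 * z * a j) ^ 2 ≤ 1) {U : Finset (Cube n)} (hU : ∀ x ∉ U, linForm a x ≤ z) :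
    Real.exp (-(24 * z ^ 2)) ≤ mu U := by
  have mean := two_mul_exp_le_expect_exp_mul_linForm ha hz haz
  have split : expect (fun x => Real.exp (4 * z * linForm a x)) ≤
      expect fun x => ind U x * Real.exp (4 * z * linForm a x) + Real.exp (4 * z ^ 2) := by
    refine expect_mono fun x => ?_
    by_cases hx : x ∈ U
    · rw [ind_of_mem hx, one_mul]
      exact le_add_of_nonneg_right (Real.exp_pos _).le
    · rw [ind_of_notMem hx, zero_mul, zero_add, Real.exp_le_exp]
      nlinarith [hU x hx]
  rw [expect_add, expect_const] at split
  have second_moment : expect (fun x => Real.exp (4 * z * linForm a x) ^ 2) ≤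
      Real.exp (32 * z ^ 2) := by
    convert expect_exp_mul_linForm_le ha.le (8 * z) using 3 with x
    · rw [← Real.exp_nat_mul]
      ring_nf
    · ring
  have hsq : Real.exp (4 * z ^ 2) ^ 2 ≤ mu U * Real.exp (32 * z ^ 2) :=
    calc Real.exp (4 * z ^ 2) ^ 2
        ≤ expect (fun x => ind U x * Real.exp (4 * z * linForm a x)) ^ 2 := by
          gcongr
          linarith
      _ ≤ expect (fun x => ind U x ^ 2) * expect fun x => Real.exp (4 * z * linForm a x) ^ 2 :=
          sq_expect_mul_le ..
      _ ≤ mu U * Real.exp (32 * z ^ 2) := by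
          rw [← expect_ind]
          gcongr
          · exact expect_nonneg fun x => sq_nonneg _
          · exact expect_nonneg fun x => (ind_mem U x).1
          · refine expect_mono fun x => ?_
            exact pow_le_of_le_one (ind_mem U x).1 (ind_mem U x).2 two_ne_zero
  rw [← div_le_iff₀ (Real.exp_pos _), ← Real.exp_nat_mul, ← Real.exp_sub] at hsq
  refine (Real.exp_le_exp.2 (le_of_eq ?_)).trans hsq
  push_cast
  ring

section Flat

variable {a : Fin n → ℝ}

theorem sum_sq_eq_one (hn : 0 < n) (ha : ∀ j, a j ^ 2 = (n : ℝ)⁻¹) : ∑ j, a j ^ 2 = 1 := by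
  simp only [ha, sum_const, card_univ, Fintype.card_fin, nsmul_eq_mul]
  exact mul_inv_cancel₀ (by exact_mod_cast hn.ne')

theorem exp_le_mu_of_linForm_le (hn : 0 < n) (ha : ∀ j, a j ^ 2 = (n : ℝ)⁻¹) {z : ℝ}
    (hz : 1 ≤ z) {U : Finset (Cube n)} (hne : U.Nonempty) (hU : ∀ x ∉ U, linForm a x ≤ z) :
    Real.exp (-(24 * z ^ 2)) ≤ mu U := by
  have hn' : (0 : ℝ) < n := by exact_mod_cast hn
  rcases le_or_gt ((4 * z) ^ 2) (n : ℝ) with hzn | hzn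
  · refine exp_le_mu_of_sq_le (sum_sq_eq_one hn ha) hz (fun j => ?_) hU
    rw [mul_pow, ha j, ← div_eq_mul_inv]
    exact (div_le_one hn').2 hzn
  · refine le_trans ?_ (inv_two_pow_le_mu hne)
    rw [Real.exp_neg]
    gcongr
    calc (2 : ℝ) ^ n ≤ Real.exp 1 ^ n := by
          gcongr
          linarith [Real.add_one_le_exp 1]
      _ = Real.exp n := by rw [← Real.exp_nat_mul, mul_one]
      _ ≤ Real.exp (24 * z ^ 2) := by
          gcongr
          nlinarith only [hzn]

theorem exists_linForm_eq_sum_abs (a : Fin n → ℝ) : ∃ x, linForm a x = ∑ j, |a j| := by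
  refine ⟨fun j => decide (0 ≤ a j), sum_congr rfl fun j _ => ?_⟩
  beta_reduce
  rcases le_or_gt 0 (a j) with h | h
  · rw [decide_eq_true h, sgn_true, mul_one, abs_of_nonneg h]
  · rw [decide_eq_false h.not_ge, sgn_false, mul_neg_one, abs_of_neg h]

theorem exp_le_mu_linForm_le_neg_one (hn : 0 < n) (ha : ∀ j, a j ^ 2 = (n : ℝ)⁻¹) :
    Real.exp (-24) ≤ mu {x | linForm a x ≤ -1} := by
  have ha_neg (j : Fin n) : (-a) j ^ 2 = (n : ℝ)⁻¹ := by rw [Pi.neg_apply, neg_sq, ha j]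
  have abs_le_one (j : Fin n) : |a j| ≤ 1 := by
    rw [← sq_le_one_iff_abs_le_one, ha j]
    exact inv_le_one_of_one_le₀ (by exact_mod_cast hn)
  have hne : ({x | linForm a x ≤ -1} : Finset (Cube n)).Nonempty := by
    obtain ⟨x, hx⟩ := exists_linForm_eq_sum_abs (-a)
    refine ⟨x, (mem_filter_univ x).2 ?_⟩
    have : (1 : ℝ) ≤ linForm (-a) x := by
      rw [hx, ← sum_sq_eq_one hn ha]
      refine sum_le_sum fun j _ => ?_
      rw [Pi.neg_apply, abs_neg, ← sq_abs]
      exact pow_le_of_le_one (abs_nonneg _) (abs_le_one j) two_ne_zero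
    rw [linForm_neg] at this
    linarith
  have h := exp_le_mu_of_linForm_le hn ha_neg le_rfl hne fun x hx => by
    rw [mem_filter_univ, not_le] at hx
    rw [linForm_neg]
    linarith
  rwa [one_pow, mul_one] at h

/-! ### The first-order weight of a half-space -/

theorem expect_ind_mul_linForm_le_one (ha : ∑ j, a j ^ 2 ≤ 1) (U : Finset (Cube n)) :
    expect (fun x => ind U x * linForm a x) ≤ 1 := by
  refine le_of_sq_le_sq ?_ zero_le_one
  calc expect (fun x => ind U x * linForm a x) ^ 2
      ≤ expect (fun x => ind U x ^ 2) * expect fun x => linForm a x ^ 2 := sq_expect_mul_le ..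
    _ ≤ 1 * 1 := by
        gcongr
        · exact expect_nonneg fun x => sq_nonneg _
        · rw [← expect_const (n := n) 1]
          exact expect_mono fun x => pow_le_one₀ (ind_mem U x).1 (ind_mem U x).2
        · exact (expect_sq_linForm_le a).trans ha
    _ = 1 ^ 2 := by norm_num

theorem mul_mu_le_expect_ind_mul_linForm {β : ℝ} {U : Finset (Cube n)}
    (hU : ∀ x ∈ U, β ≤ linForm a x) : β * mu U ≤ expect fun x => ind U x * linForm a x := by
  rw [mul_comm, ← expect_ind, ← expect_mul_const]
  refine expect_mono fun x => ?_
  by_cases hx : x ∈ U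
  · simpa only [ind_of_mem hx, one_mul] using hU x hx
  · simp only [ind_of_notMem hx, zero_mul, le_refl]

theorem exp_mul_mu_le_expect_ind_mul_linForm (hn : 0 < n) (ha : ∀ j, a j ^ 2 = (n : ℝ)⁻¹)
    {β : ℝ} (hβ : 0 ≤ β) {U : Finset (Cube n)} (hU : ∀ x ∈ U, β ≤ linForm a x)
    (hUc : ∀ x ∉ U, linForm a x ≤ β) :
    Real.exp (-24) * mu U ≤ expect fun x => ind U x * linForm a x := by
  obtain ⟨hμ0, hμ1⟩ := mu_mem U
  have hcov : expect (fun x => ind U x * linForm a x) =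
      expect fun x => (ind U x - mu U) * (linForm a x - β) := by
    rw [← expect_ind U, ← covFun_eq_expect, covFun, expect_linForm, mul_zero, sub_zero]
  calc Real.exp (-24) * mu U
      ≤ expect (ind ({x | linForm a x ≤ -1} : Finset (Cube n))) * mu U := by
        rw [expect_ind]
        gcongr
        exact exp_le_mu_linForm_le_neg_one hn ha
    _ ≤ expect fun x => ind U x * linForm a x := by
        rw [hcov, ← expect_mul_const]
        refine expect_mono fun x => ?_
        by_cases hx : x ∈ U
        · have hβx := hU x hx
          rw [ind_of_mem hx, ind_of_notMem (by rw [mem_filter_univ]; linarith), zero_mul]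
          exact mul_nonneg (by linarith) (by linarith)
        · have hβx := hUc x hx
          rw [ind_of_notMem hx]
          by_cases hneg : linForm a x ≤ -1
          · rw [ind_of_mem ((mem_filter_univ x).2 hneg)]
            nlinarith
          · rw [ind_of_notMem (by rwa [mem_filter_univ]), zero_mul]
            exact mul_nonneg_of_nonpos_of_nonpos (by linarith) (by linarith)

theorem sqrt_log_exp_sq_div_sq_le {s z : ℝ} (hz : 1 ≤ z) (hs : Real.exp (-(48 * z ^ 2)) ≤ s) :
    √(Real.log (Real.exp 1 ^ 2 / s ^ 2)) ≤ 10 * z := by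
  have hs0 : 0 < s := (Real.exp_pos _).trans_le hs
  have hlog := (Real.le_log_iff_exp_le hs0).2 hs
  rw [Real.sqrt_le_left (by linarith), ← div_pow, Real.log_pow,
    Real.log_div (Real.exp_ne_zero 1) hs0.ne', Real.log_exp]
  push_cast
  nlinarith only [hlog, hz]

theorem exists_exp_le_mu_and_mul_mu_le (hn : 0 < n) (ha : ∀ j, a j ^ 2 = (n : ℝ)⁻¹) {β : ℝ}
    (hβ : 0 ≤ β) {U : Finset (Cube n)} (hne : U.Nonempty) (hU : ∀ x ∈ U, β ≤ linForm a x)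
    (hUc : ∀ x ∉ U, linForm a x ≤ β) :
    ∃ z, 1 ≤ z ∧ Real.exp (-(24 * z ^ 2)) ≤ mu U ∧
      Real.exp (-24) * z * mu U ≤ expect fun x => ind U x * linForm a x := by
  refine ⟨max 1 β, le_max_left .., exp_le_mu_of_linForm_le hn ha (le_max_left ..) hne fun x hx =>
    (hUc x hx).trans (le_max_right ..), ?_⟩
  rcases max_choice 1 β with h | h
  · rw [h, mul_one]
    exact exp_mul_mu_le_expect_ind_mul_linForm hn ha hβ hU hUc
  · rw [h, mul_assoc]
    exact (mul_le_of_le_one_left (mul_nonneg hβ (mu_mem U).1)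
      (Real.exp_le_one_iff.2 (by norm_num))).trans (mul_mu_le_expect_ind_mul_linForm hU)

theorem exp_div_five_mul_mu_le_of_threshold (hn : 0 < n) (ha : ∀ j, a j ^ 2 = (n : ℝ)⁻¹) {β : ℝ}
    (hβ : 0 ≤ β) {U : Finset (Cube n)} (hne : U.Nonempty) (hU : ∀ x ∈ U, β ≤ linForm a x)
    (hUc : ∀ x ∉ U, linForm a x ≤ β) {s : ℝ}
    (hs : s = 2 * expect fun x => ind U x * linForm a x) :
    Real.exp (-24) / 5 * mu U ≤ s / √(Real.log (Real.exp 1 ^ 2 / s ^ 2)) := by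
  obtain ⟨z, hz, tail, weight⟩ := exists_exp_le_mu_and_mul_mu_le hn ha hβ hne hU hUc
  have hμ0 := (mu_mem U).1
  have hs_exp : Real.exp (-(48 * z ^ 2)) ≤ s :=
    calc Real.exp (-(48 * z ^ 2)) = Real.exp (-(24 * z ^ 2)) * Real.exp (-(24 * z ^ 2)) := by
          rw [← Real.exp_add]
          ring_nf
      _ ≤ Real.exp (-24) * mu U := by
          gcongr
          nlinarith only [hz]
      _ ≤ 2 * (Real.exp (-24) * z * mu U) := by
          nlinarith only [hz, mul_nonneg (Real.exp_pos (-24)).le hμ0]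
      _ ≤ s := by linarith
  have hs0 : 0 < s := (Real.exp_pos _).trans_le hs_exp
  have hs2 : s ≤ 2 := by
    linarith [expect_ind_mul_linForm_le_one (sum_sq_eq_one hn ha).le U]
  have hlog : 0 < Real.log (Real.exp 1 ^ 2 / s ^ 2) := by
    refine Real.log_pos ((one_lt_div (by positivity)).2 ?_)
    gcongr
    linarith [Real.exp_one_gt_d9]
  rw [le_div_iff₀ (Real.sqrt_pos.2 hlog)]
  calc Real.exp (-24) / 5 * mu U * √(Real.log (Real.exp 1 ^ 2 / s ^ 2))
      ≤ Real.exp (-24) / 5 * mu U * (10 * z) := by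
        gcongr
        exact sqrt_log_exp_sq_div_sq_le hz hs_exp
    _ = 2 * (Real.exp (-24) * z * mu U) := by ring
    _ ≤ s := by linarith

theorem exp_div_five_mul_mu_mul_one_sub_mu_le (hn : 0 < n) (ha : ∀ j, a j ^ 2 = (n : ℝ)⁻¹)
    {U : Finset (Cube n)} (hU : ∀ x ∈ U, ∀ y ∉ U, linForm a y ≤ linForm a x) {s : ℝ}
    (hs : s = 2 * expect fun x => ind U x * linForm a x) :
    Real.exp (-24) / 5 * (mu U * (1 - mu U)) ≤ s / √(Real.log (Real.exp 1 ^ 2 / s ^ 2)) := by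
  obtain ⟨hμ0, hμ1⟩ := mu_mem U
  have hcompl : s = 2 * expect fun x => ind Uᶜ x * linForm (-a) x := by
    have (x : Cube n) : ind Uᶜ x * linForm (-a) x = ind U x * linForm a x - linForm a x := by
      rw [ind_compl, linForm_neg]
      ring
    rw [hs, funext this, expect_sub, expect_linForm, sub_zero]
  rcases U.eq_empty_or_nonempty with rfl | hne
  · simp [hs, mu, ind, expect_const]
  rcases Uᶜ.eq_empty_or_nonempty with hempty | hcne
  · rw [← mu_compl, hcompl]
    simp [hempty, mu, ind, expect_const]
  obtain ⟨x, hx, hmin⟩ := exists_min_image U (linForm a) hne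
  obtain ⟨y, hy, hmax⟩ := exists_max_image Uᶜ (linForm a) hcne
  rw [mem_compl] at hy
  rcases le_or_gt 0 (linForm a x) with h0 | h0
  · refine le_trans ?_ (exp_div_five_mul_mu_le_of_threshold hn ha h0 hne hmin (hU x hx) hs)
    gcongr
    exact mul_le_of_le_one_right hμ0 (by linarith)
  · refine le_trans ?_ (exp_div_five_mul_mu_le_of_threshold hn (a := -a) (β := -linForm a y)
      (fun j => by rw [Pi.neg_apply, neg_sq, ha j]) (by linarith [hU x hx y hy]) hcne
      (fun w hw => by rw [linForm_neg]; exact neg_le_neg (hmax w hw))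
      (fun w hw => by
        rw [linForm_neg]
        exact neg_le_neg (hU w (by simpa only [mem_compl, not_not] using hw) y hy)) hcompl)
    rw [mu_compl]
    gcongr
    exact mul_le_of_le_one_left (by linarith) hμ1

end Flat

/-! ### Influences of families -/

theorem ind_mono {A : Finset (Cube n)} (hA : Increasing A) : Monotone (ind A) := by
  intro x y hxy
  by_cases hx : x ∈ A
  · rw [ind_of_mem hx, ind_of_mem (hA x y hx hxy)]
  · rw [ind_of_notMem hx]
    exact (ind_mem A y).1

theorem ind_symm {A : Finset (Cube n)} (hs : FullySymmetric A) : FullySymmetricFun (ind A) :=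
  fun σ x => by simp only [ind, hs σ x]

theorem cov_eq_covFun (A B : Finset (Cube n)) : cov A B = covFun (ind A) (ind B) := by
  have inter (x : Cube n) : ind (A ∩ B) x = ind A x * ind B x := by
    by_cases hA : x ∈ A <;> by_cases hB : x ∈ B <;> simp [ind, hA, hB]
  rw [cov, covFun, ← funext inter, expect_ind, expect_ind, expect_ind]

theorem influence_eq_influenceFun (A : Finset (Cube n)) (k : Fin n) :
    influence A k = influenceFun (ind A) k := by
  set D := A.filter fun x => flip k x ∉ A with hD
  have abs_sub (x : Cube n) : |ind A x - ind A (flip k x)| = ind D x + ind D (flip k x) := by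
    by_cases hx : x ∈ A <;> by_cases hk : flip k x ∈ A <;> simp [ind, hD, hx, hk, flip_flip]
  rw [influence, influenceFun, funext abs_sub, expect_add, expect_flip, expect_ind, two_mul]

theorem influence_mem (A : Finset (Cube n)) (k : Fin n) :
    influence A k ∈ Set.Icc (0 : ℝ) 1 := by
  rw [influence_eq_influenceFun]
  exact expect_mem_Icc fun x =>
    ⟨abs_nonneg _, Real.dist_le_of_mem_Icc_01 (ind_mem A x) (ind_mem A (flip k x))⟩

theorem W1_self {B : Finset (Cube n)} (hs : FullySymmetric B) (k : Fin n) :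
    W1 B B = n * influence B k ^ 2 := by
  have heq (i : Fin n) : influence B i = influence B k := by
    rw [influence_eq_influenceFun, influence_eq_influenceFun,
      influenceFun_eq_of_fullySymmetricFun (ind_symm hs) i k]
  simp only [W1, heq, sum_const, card_univ, Fintype.card_fin, nsmul_eq_mul, sq]

theorem mul_sq_influence_le_one {B : Finset (Cube n)} (hB : Increasing B)
    (hs : FullySymmetric B) (k : Fin n) : n * influence B k ^ 2 ≤ 1 := by
  have h := sqrt_mul_influenceFun_le (ind_mono hB) (ind_symm hs) (ind_mem B) k
  rw [← influence_eq_influenceFun, sub_zero] at h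
  rw [← Real.sq_sqrt (Nat.cast_nonneg (α := ℝ) n), ← mul_pow]
  exact pow_le_one₀ (mul_nonneg (Real.sqrt_nonneg _) (influence_mem B k).1) h

theorem psi_nonneg {t : ℝ} (ht : 0 ≤ t) : 0 ≤ psi t := div_nonneg ht (Real.sqrt_nonneg _)

theorem div_sqrt_log_exp_pow_le_two_mul {a t : ℝ} {p : ℕ} (ha : 0 ≤ a) (ht0 : 0 < t) (ht1 : t ≤ 1) :
    a / √(Real.log (Real.exp 1 ^ (p + 1) / t)) ≤
      2 * (a / √(Real.log (Real.exp 1 ^ (p + 2) / t))) := by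
  have one_le (q : ℕ) : 1 ≤ Real.log (Real.exp 1 ^ (q + 1) / t) :=
    one_le_log_exp_pow_div ht0 (ht1.trans (one_le_pow₀ (Real.one_le_exp zero_le_one)))
  have hlog : Real.log (Real.exp 1 ^ (p + 2) / t) =
      1 + Real.log (Real.exp 1 ^ (p + 1) / t) := by
    rw [pow_succ', mul_div_assoc, Real.log_mul (Real.exp_ne_zero 1) (by positivity), Real.log_exp]
  have hsqrt : √(Real.log (Real.exp 1 ^ (p + 2) / t)) ≤
      2 * √(Real.log (Real.exp 1 ^ (p + 1) / t)) := by
    rw [Real.sqrt_le_left (by positivity), mul_pow, Real.sq_sqrt (zero_le_one.trans (one_le p))]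
    linarith [one_le p]
  have hpos (q : ℕ) : 0 < √(Real.log (Real.exp 1 ^ (q + 1) / t)) :=
    Real.sqrt_pos.2 (zero_lt_one.trans_le (one_le q))
  rw [← mul_div_assoc, div_le_div_iff₀ (hpos p) (hpos (p + 1)), mul_comm 2 a, mul_assoc]
  gcongr

theorem psi_le_two_mul {t : ℝ} (ht : t ∈ Set.Icc (0 : ℝ) 1) :
    psi t ≤ 2 * (t / √(Real.log (Real.exp 1 ^ 2 / t))) := by
  rcases ht.1.eq_or_lt with rfl | h0
  · simp only [psi, zero_div, mul_zero, le_refl]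
  · simpa only [psi, zero_add, pow_one] using div_sqrt_log_exp_pow_le_two_mul (p := 0) h0.le h0 ht.2

theorem influence_div_sqrt_log_W1_le {B : Finset (Cube n)} (hB : Increasing B)
    (hs : FullySymmetric B) (k : Fin n) :
    influence B k / √(Real.log (Real.exp 1 ^ 2 / W1 B B)) ≤
      2 * (influence B k / √(Real.log (Real.exp 1 ^ 3 / (n * influence B k ^ 2)))) := by
  have hn : (0 : ℝ) < n := by exact_mod_cast k.pos
  rw [W1_self hs k]
  rcases (influence_mem B k).1.eq_or_lt with h0 | h0
  · simp only [← h0, zero_div, mul_zero, le_refl]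
  · exact div_sqrt_log_exp_pow_le_two_mul (p := 1) h0.le (by positivity)
      (mul_sq_influence_le_one hB hs k)

theorem sum_psi_influence_mul_le_cov {A B : Finset (Cube n)} (hA : Increasing A)
    (hB : Increasing B) (hs : FullySymmetric B) :
    1 / 4096 * ∑ i, psi (influence A i) *
      (influence B i / √(Real.log (Real.exp 1 ^ 2 / W1 B B))) ≤ cov A B := by
  have ind_mem' (C : Finset (Cube n)) (x : Cube n) : ind C x ∈ Set.Icc (-1 : ℝ) 1 :=
    Set.Icc_subset_Icc_left (by norm_num) (ind_mem C x)
  have h := sum_influenceFun_mul_influenceFun_le_covFun (ind_mem' B) (ind_mem' A) (ind_mono hB)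
    (ind_mono hA) (ind_symm hs)
  simp only [← influence_eq_influenceFun] at h
  rw [cov_eq_covFun, covFun_comm]
  refine le_trans ?_ h
  rw [mul_sum, mul_sum]
  refine sum_le_sum fun i _ => ?_
  have hmul := mul_le_mul (psi_le_two_mul (influence_mem A i))
    (influence_div_sqrt_log_W1_le hB hs i)
    (div_nonneg (influence_mem B i).1 (Real.sqrt_nonneg _))
    (mul_nonneg zero_le_two (div_nonneg (influence_mem A i).1 (Real.sqrt_nonneg _)))
  linarith

theorem exp_div_five_mul_mu_div_sqrt_le {B : Finset (Cube n)} (hB : Increasing B)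
    (hs : FullySymmetric B) (k : Fin n) :
    Real.exp (-24) / 5 * (mu B * (1 - mu B) / √n) ≤
      influence B k / √(Real.log (Real.exp 1 ^ 2 / W1 B B)) := by
  have hn : (0 : ℝ) < n := by exact_mod_cast k.pos
  have hs_sq : n * influence B k ^ 2 = (√n * influence B k) ^ 2 := by
    rw [mul_pow, Real.sq_sqrt hn.le]
  have half_space (x) (hx : x ∈ B) (y) (hy : y ∉ B) : normSum y ≤ normSum x :=
    monovary_of_fullySymmetricFun normSum_mono normSum_symm (ind_mono hB) (ind_symm hs)
      (by rw [ind_of_mem hx, ind_of_notMem hy]; exact zero_lt_one)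
  have h := exp_div_five_mul_mu_mul_one_sub_mu_le k.pos
    (fun _ => by rw [inv_pow, Real.sq_sqrt hn.le]) half_space
    (sqrt_mul_influenceFun (ind_mono hB) (ind_symm hs) k)
  rw [← influence_eq_influenceFun, ← hs_sq, ← W1_self hs, mul_div_assoc] at h
  rw [← mul_div_assoc, div_le_iff₀' (Real.sqrt_pos.2 hn)]
  exact h

theorem mul_sum_psi_influence_le_sum_psi_influence_mul (A : Finset (Cube n)) {B : Finset (Cube n)}
    (hB : Increasing B) (hs : FullySymmetric B) :
    Real.exp (-24) / 5 * (mu B * (1 - mu B) / √n) * ∑ i, psi (influence A i) ≤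
      ∑ i, psi (influence A i) * (influence B i / √(Real.log (Real.exp 1 ^ 2 / W1 B B))) := by
  rw [mul_comm, sum_mul]
  exact sum_le_sum fun i _ => mul_le_mul_of_nonneg_left (exp_div_five_mul_mu_div_sqrt_le hB hs i)
    (psi_nonneg (influence_mem A i).1)

end DiscreteCube

theorem mainTheorem3 :
    (∃ c₁ c₂ : ℝ, 0 < c₁ ∧ 0 < c₂ ∧
      ∀ (n : ℕ) (A B : Finset (DiscreteCube.Cube n)),
        DiscreteCube.Increasing A → DiscreteCube.Increasing B →
        DiscreteCube.FullySymmetric B →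
          DiscreteCube.cov A B ≥
            c₁ * ∑ i, DiscreteCube.psi (DiscreteCube.influence A i) *
              (DiscreteCube.influence B i /
                √(Real.log (Real.exp 1 ^ 2 / DiscreteCube.W1 B B))) ∧
          c₁ * ∑ i, DiscreteCube.psi (DiscreteCube.influence A i) *
              (DiscreteCube.influence B i /
                √(Real.log (Real.exp 1 ^ 2 / DiscreteCube.W1 B B))) ≥
            c₂ * (DiscreteCube.mu B * (1 - DiscreteCube.mu B) / √(n : ℝ)) *
              ∑ i, DiscreteCube.psi (DiscreteCube.influence A i)) ∧
    (∃ c : ℝ, 0 < c ∧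
      ∀ (n : ℕ) (f g : DiscreteCube.Cube n → ℝ),
        (∀ x, f x ∈ Set.Icc (-1 : ℝ) 1) → (∀ x, g x ∈ Set.Icc (-1 : ℝ) 1) →
        Monotone f → Monotone g → DiscreteCube.FullySymmetricFun f →
          DiscreteCube.covFun f g ≥
            c * ∑ i,
              (DiscreteCube.influenceFun f i /
                √(Real.log (Real.exp 1 ^ 3 / ((n : ℝ) * DiscreteCube.influenceFun f i ^ 2)))) *
              (DiscreteCube.influenceFun g i /
                √(Real.log (Real.exp 1 ^ 2 / DiscreteCube.influenceFun g i)))) := by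
  refine ⟨⟨1 / 4096, 1 / 4096 * (Real.exp (-24) / 5), by norm_num, by positivity,
    fun n A B hA hB hs => ⟨DiscreteCube.sum_psi_influence_mul_le_cov hA hB hs, ?_⟩⟩,
    1 / 1024, by norm_num, fun n f g hf1 hg1 hf hg hs =>
      DiscreteCube.sum_influenceFun_mul_influenceFun_le_covFun hf1 hg1 hf hg hs⟩
  rw [ge_iff_le, mul_assoc (1 / 4096 : ℝ), mul_assoc (1 / 4096 : ℝ)]
  exact mul_le_mul_of_nonneg_left
    (DiscreteCube.mul_sum_psi_influence_le_sum_psi_influence_mul A hB hs) (by norm_num)
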